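/- Notation. Let $\mathcal C\subset\mathbb R^2=\mathbb C$ be the unit circle with geodesic distance $d_{\mathcal C}$, let $\mathcal O$ be the orthogonal group of $\mathbb R^2$, and let $\mathcal C_k=\{e^{2\pi\iota j/k}: j=0,\dots,k-1\}$. Let $n\ge 1$ be a multiple of $4$, $n_0=n/4$, $[n]=\{1,\dots,n\}$, $d(a,b)=\min(|a-b|,\,n-|a-b|)$ the torus distance on $[n]$, and let $\Gamma_n$ be the group of permutations of $[n]$ generated by the circular permutation $k\mapsto k+1$ (mod $n$) and the reversal $k\mapsto n+1-k$. Data. Let $F\in\mathbb R^{n\times n}$ be symmetric, and let $\sigma^*$ be a permutation of $[n]$, where $\sigma^*(a)$ is the latent position of the item $a$ on the torus. Let $0<c_l\le c_L$, $c_e\ge0$ and $\varepsilon_n=c_e\sqrt{\log(n)/n}$, and assume that the reordered matrix $G_{ij}=F_{(\sigma^*)^{-1}(i)\,(\sigma^*)^{-1}(j)}$ is bi-Lipschitz with respect to the torus distance: for all $i,j,k\in[n]$, $$|G_{ij}-G_{ik}|\le c_L\tfrac{2\pi}{n}d(j,k)+\varepsilon_n,\qquad G_{ik}-G_{ij}\ge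 c_l\tfrac{2\pi}{n}\big(d(i,j)-d(i,k)\big)-\varepsilon_n\ \text{ if } d(i,j)\ge d(i,k).$$ One observes the symmetric matrix $A$ with $A_{ii}=0$ and $A_{ij}=F_{ij}+E_{ij}$ for $i<j$, where the $E_{ij}$, $i<j$, are independent, centred and jointly subGaussian(1): for all real $(B_{ij})_{i<j}$ and $t\ge0$, $\mathbb P\big[\sum_{i<j}B_{ij}E_{ij}>t\,(\sum_{i<j}B_{ij}^2)^{1/2}\big]\le e^{-t^2/2}$. Procedure (Localize-and-Refine). Draw, independently of $E$, a subset $S\subset[n]$ uniformly among those of cardinality $n_0$, and then $S'\subset\overline S$ uniformly among those of cardinality $n_0$. For $T\in\{S,S'\}$, let $\boldsymbol\Pi_T$ be the set of the tuples $(x_j)_{j\in T}$ that enumerate $\mathcal C_{n_0}$, each point once; choose, as a measurable function of $T$ and $A_{TT}$ only, $$\hat x^{(1)}_T\in\operatorname*{argmin}_{x\in\boldsymbol\Pi_T}\sum_{i,j\in T}A_{ij}\,d_{\mathcal C}(x_i,x_j),$$ and then, for $i\notin T$, any $$\hat x^{(2,T)}_i\in\operatorname*{argmin}_{z\in\mathcal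 C_{n_0}}\sum_{j\in T}A_{ij}\,d_{\mathcal C}(z,\hat x^{(1)}_j).$$ Let $\widehat Q\in\mathcal O$ be any minimizer of $\max_{i\in\overline S\cap\overline{S'}}d_{\mathcal C}(\hat x^{(2,S)}_i,Q\hat x^{(2,S')}_i)$ over $Q\in\mathcal O$. Put $\hat x_j=\hat x^{(2,S)}_j$ for $j\notin S$ and $\hat x_j=\widehat Q\hat x^{(2,S')}_j$ for $j\in S$. Finally, let $\hat\sigma(i)=\lceil n\,\underline{\hat x}_i/(2\pi)\rceil\in[n]$, where $\underline{\hat x}_i\in(0,2\pi]$ is the argument of $\hat x_i$. Statement. There is a constant $C_{lLe}>0$, depending only on $c_l,c_L,c_e$, such that, for all such $n$, $F$, $\sigma^*$ and $E$, with probability at least $1-5/n^2$, $$\min_{\tau\in\Gamma_n}\ \max_{i\in[n]}\ d\big(\tau\circ\sigma^*(i),\hat\sigma(i)\big)\le C_{lLe}\sqrt{n\log n}.$$ -/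

import Mathlib

open MeasureTheory ProbabilityTheory

noncomputable section

namespace ToroidalSeriation

/-! ### The unit circle, its geodesic distance, and the orthogonal group of the plane -/

/-- The geodesic distance on the unit circle, i.e. the unoriented angle (in `[0, π]`) between two
unit vectors of `ℂ = ℝ²`. -/
def geoDist (x y : Circle) : ℝ := InnerProductGeometry.angle (x : ℂ) (y : ℂ)

/-- The action on the unit circle of an orthogonal transformation of `ℂ = ℝ²`
(a rotation or a reflection). -/
def orthAct (Q : ℂ ≃ₗᵢ[ℝ] ℂ) (x : Circle) : Circle :=
  ⟨Q (x : ℂ), mem_sphere_zero_iff_norm.2 ((Q.norm_map _).trans (Circle.norm_coe x))⟩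

/-- The point `exp(2πι j / k)` of the regular grid with `k` points. -/
def gridPoint (k : ℕ) (j : Fin k) : Circle := Circle.exp (2 * Real.pi * (j : ℝ) / k)

/-- The regular grid with `k` points on the circle. -/
def grid (k : ℕ) : Set Circle := Set.range (gridPoint k)

/-- The regular positions indexed by `T`: the tuples `(x_j)_{j ∈ T}` that enumerate the regular
grid with `k` points, each point once (so there is none unless `T` has `k` elements). -/
def regularTuples {n : ℕ} (T : Finset (Fin n)) (k : ℕ) : Set (T → Circle) :=
  {x | ∃ e : T ≃ Fin k, ∀ j, x j = gridPoint k (e j)}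

/-- The argument in `(0, 2π]` of a point of the circle. -/
def argPos (x : Circle) : ℝ := toIocMod Real.two_pi_pos 0 (Complex.arg (x : ℂ))

/-! ### The torus `{1, …, n}` -/

/-- The torus distance `min (|a - b|, n - |a - b|)` of `a, b ∈ {1, …, n}`. -/
def torusDist (n : ℕ) (a b : ℤ) : ℤ := min |a - b| (n - |a - b|)

/-- The elements of `Fin n` are the labels `1, …, n`. -/
def label {n : ℕ} (i : Fin n) : ℤ := (i : ℤ) + 1

/-- The group of permutations of `{1, …, n}` that is generated by the circular permutation
`k ↦ k + 1` (modulo `n`) and the reversal `k ↦ n + 1 - k`. -/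
def symmetryGroup (n : ℕ) : Subgroup (Equiv.Perm (Fin n)) :=
  Subgroup.closure {finRotate n, Fin.revPerm}

/-- The slack `ε_n = c_e √(log n / n)`. -/
def slack (ce : ℝ) (n : ℕ) : ℝ := ce * Real.sqrt (Real.log n / n)

/-- The bi-Lipschitz condition with respect to the torus distance, for a matrix whose rows and
columns are indexed by the positions `1, …, n` on the torus. -/
structure TorusBiLipschitz {n : ℕ} (cl cL ce : ℝ) (G : Matrix (Fin n) (Fin n) ℝ) : Prop where
  upper : ∀ i j k, |G i j - G i k| ≤
    cL * (2 * Real.pi / n) * torusDist n (label j) (label k) + slack ce n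
  lower : ∀ i j k, torusDist n (label i) (label k) ≤ torusDist n (label i) (label j) →
    cl * (2 * Real.pi / n) *
      ((torusDist n (label i) (label j) : ℝ) - torusDist n (label i) (label k)) - slack ce n
      ≤ G i k - G i j

/-! ### The observations -/

/-- The pairs `(i, j)` with `i < j`. -/
abbrev Pairs (n : ℕ) : Type := {p : Fin n × Fin n // p.1 < p.2}

/-- The noise `(E_ij)_{i < j}`: independent, centred random variables that are jointly
subGaussian(1). -/
structure IsSubGaussianNoise {n : ℕ} {Ω : Type*} [MeasurableSpace Ω] (μ : Measure Ω)
    (E : Pairs n → Ω → ℝ) : Prop where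
  measurable : ∀ p, Measurable (E p)
  indep : iIndepFun E μ
  centred : ∀ p, ∫ ω, E p ω ∂μ = 0
  tail : ∀ (B : Pairs n → ℝ) (t : ℝ), 0 ≤ t →
    μ.real {ω | t * Real.sqrt (∑ p, B p ^ 2) < ∑ p, B p * E p ω} ≤ Real.exp (-t ^ 2 / 2)

/-- The observed symmetric matrix: `A_ij = F_ij + E_ij` for `i < j`, and `A_ii = 0`. -/
def observation {n : ℕ} (F : Matrix (Fin n) (Fin n) ℝ) (e : Pairs n → ℝ) :
    Matrix (Fin n) (Fin n) ℝ := fun i j =>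
  if h : i < j then F i j + e ⟨(i, j), h⟩
  else if h : j < i then F j i + e ⟨(j, i), h⟩
  else 0

/-! ### The Localize-and-Refine procedure -/

/-- The possible values of the pair `(S, S')`: two disjoint subsets with `n / 4` elements each. -/
def splits (n : ℕ) : Finset (Finset (Fin n) × Finset (Fin n)) :=
  (Finset.powersetCard (n / 4) Finset.univ ×ˢ Finset.powersetCard (n / 4) Finset.univ).filter
    fun P => Disjoint P.1 P.2

/-- `S` is drawn uniformly among the subsets with `n / 4` elements, and then `S'` uniformly among
the subsets of the complement of `S` with `n / 4` elements. As the number of choices for `S'` does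
not depend on `S`, this says that `(S, S')` is uniform on `splits n`. -/
structure IsUniformSplit {n : ℕ} {Ω : Type*} [MeasurableSpace Ω] (μ : Measure Ω)
    (S S' : Ω → Finset (Fin n)) : Prop where
  measurable_fst : Measurable S
  measurable_snd : Measurable S'
  uniform : ∀ P ∈ splits n, μ.real {ω | (S ω, S' ω) = P} = 1 / ((splits n).card : ℝ)

/-- The criterion `⟨A_TT, D(x_T)⟩` of the initial localization. -/
def initCriterion {n : ℕ} {T : Finset (Fin n)} (M : T → T → ℝ) (x : T → Circle) : ℝ :=
  ∑ i, ∑ j, M i j * geoDist (x i) (x j)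

/-- A rule for the initial localization: for each subset `T` with `n / 4` elements, it selects a
minimizer of the criterion over the regular positions indexed by `T`, as a measurable function of
the block `A_TT` of the observations. (There are finitely many regular positions, so measurability
is that of the level sets.) -/
structure IsInitRule {n : ℕ}
    (init : (T : Finset (Fin n)) → (T → T → ℝ) → (T → Circle)) : Prop where
  mem : ∀ T : Finset (Fin n), T.card = n / 4 → ∀ M, init T M ∈ regularTuples T (n / 4)
  isMinOn : ∀ T : Finset (Fin n), T.card = n / 4 → ∀ M,
    IsMinOn (initCriterion M) (regularTuples T (n / 4)) (init T M)
  measurable : ∀ T : Finset (Fin n), T.card = n / 4 → ∀ x, MeasurableSet {M | init T M = x}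

/-- The refined localization of the point `i`, given initial positions `x` of the points of `T`:
`z` minimizes `⟨A_{i,T}, D(z, x)⟩` over the regular grid with `n / 4` points. -/
def IsRefined {n : ℕ} (A : Matrix (Fin n) (Fin n) ℝ) (T : Finset (Fin n)) (x : T → Circle)
    (i : Fin n) (z : Circle) : Prop :=
  z ∈ grid (n / 4) ∧ IsMinOn (fun w => ∑ j : T, A i j * geoDist w (x j)) (grid (n / 4)) z

/-- The `d_∞`-distance of `y` and `Q y'` over the points outside `S ∪ S'`. -/
def mergeCriterion {n : ℕ} (S S' : Finset (Fin n)) (y y' : Fin n → Circle)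
    (Q : ℂ ≃ₗᵢ[ℝ] ℂ) : ℝ :=
  ⨆ i : {i : Fin n // i ∉ S ∧ i ∉ S'}, geoDist (y i) (orthAct Q (y' i))

/-- `x` is an output of the Localize-and-Refine procedure on the matrix `A`, with the subsets
`S, S'`, and with the rules `init, init'` for the two initial localizations. Every choice of the
minimizers in the refinement and the merging steps is allowed. -/
def IsOutput {n : ℕ} (init init' : (T : Finset (Fin n)) → (T → T → ℝ) → (T → Circle))
    (A : Matrix (Fin n) (Fin n) ℝ) (S S' : Finset (Fin n)) (x : Fin n → Circle) : Prop :=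
  ∃ (y y' : Fin n → Circle) (Q : ℂ ≃ₗᵢ[ℝ] ℂ),
    (∀ i ∉ S, IsRefined A S (init S fun j k => A j k) i (y i)) ∧
    (∀ i ∉ S', IsRefined A S' (init' S' fun j k => A j k) i (y' i)) ∧
    IsMinOn (mergeCriterion S S' y y') Set.univ Q ∧
    (∀ i ∉ S, x i = y i) ∧
    (∀ i ∈ S, x i = orthAct Q (y' i))

/-- The map `σ̂(i) = ⌈n arg(x̂_i) / 2π⌉`, with the argument in `(0, 2π]`. -/
def sigmaHat {n : ℕ} (x : Fin n → Circle) (i : Fin n) : ℤ :=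
  ⌈(n : ℝ) * argPos (x i) / (2 * Real.pi)⌉

/-- `σ̂` takes its values in `{1, …, n}`. -/
theorem sigmaHat_mem {n : ℕ} (x : Fin n → Circle) (i : Fin n) :
    sigmaHat x i ∈ Set.Icc (1 : ℤ) n := by
  have hn : (0 : ℝ) < n := by exact_mod_cast i.pos
  have h := toIocMod_mem_Ioc Real.two_pi_pos 0 (Complex.arg (x i : ℂ))
  have h0 : 0 < argPos (x i) := h.1
  have h1 : argPos (x i) ≤ 2 * Real.pi := by simpa [argPos] using h.2
  have hp := Real.two_pi_pos
  constructor
  · have : (0 : ℤ) < sigmaHat x i := Int.ceil_pos.2 (by positivity)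
    omega
  · refine Int.ceil_le.2 ?_
    rw [div_le_iff₀ hp]
    push_cast
    gcongr

end ToroidalSeriation

end

open ToroidalSeriation

open ToroidalSeriation
open Real (pi_pos)

/-! Put each item `i` at the latent point `u i = exp(2πι σ(i) / n)`. Torus distance becomes geodesic
distance, and each row of `F` decreases at rate `cl` in that distance, up to a slack. The engine is
`rearrangement_quadratic`: seen from any grid point, the distances to the whole grid are the same
numbers in another order, so replacing oracle positions by other regular positions costs at least
`cl / 2` times the squared change of the distances, up to a slack term. The noise enters through a
linear form, of order √(n log n) times the Frobenius norm of the change, uniformly over the at most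
n^n enumerations. Balancing the two, a minimizer has a distance matrix within O(√(n log n)) of the
oracle one (`init_localization`), and `exists_orthAct_sum_sq_le` turns this into closeness of the
points after one orthogonal map, with average error O(√(log n / n)).

Refinement makes this error uniform (`refine_localization`). For a single item displaced by ζ, the
gain is of order n ζ², against O(√(n log n)) ζ for the noise and the initial errors, so ζ = O(√(log
n / n)). The noise of an item outside `T` is independent of the block that fixed the initial
positions, so a union bound over items and pairs of grid points suffices
(`measureReal_not_refineNoiseBound_init_le`).

The two families of positions are each known up to their own orthogonal map. At least half of the
items lie outside both subsets, two of them in general position, so the merging criterion aligns the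
two maps everywhere (`merge_localization`). An orthogonal map is finally rounded to an element of
the symmetry group (`exists_symmetryGroup_near`).

A good oracle exists because most subsets are spread over the torus, by a Chernoff bound for
sampling without replacement (`card_not_isSpread_le`); matching by rank then puts `T` on the grid
with displacement O(√(log n / n)). -/

/-! ### Geodesic distance on the circle and orthogonal maps. -/

theorem geoDist_nonneg (x y : Circle) : 0 ≤ geoDist x y := InnerProductGeometry.angle_nonneg _ _

theorem geoDist_le_pi (x y : Circle) : geoDist x y ≤ Real.pi := InnerProductGeometry.angle_le_pi _ _

theorem geoDist_comm (x y : Circle) : geoDist x y = geoDist y x := InnerProductGeometry.angle_comm _ _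

theorem geoDist_self (x : Circle) : geoDist x x = 0 :=
  InnerProductGeometry.angle_self (Circle.coe_ne_zero x)

theorem geoDist_triangle (x y z : Circle) : geoDist x z ≤ geoDist x y + geoDist y z :=
  InnerProductGeometry.angle_le_angle_add_angle _ _ _

theorem abs_geoDist_sub_le (x y z : Circle) : |geoDist x z - geoDist y z| ≤ geoDist x y := by
  have h1 := geoDist_triangle x y z
  have h2 := geoDist_triangle y x z
  rw [geoDist_comm y x] at h2
  exact abs_le.2 ⟨by linarith, by linarith⟩

theorem abs_geoDist_sub_le_right (x y z : Circle) :
    |geoDist z x - geoDist z y| ≤ geoDist x y := by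
  rw [geoDist_comm z x, geoDist_comm z y]
  exact abs_geoDist_sub_le x y z

theorem abs_geoDist_sub_geoDist_le (x y x' y' : Circle) :
    |geoDist x y - geoDist x' y'| ≤ geoDist x x' + geoDist y y' := by
  have h1 := abs_geoDist_sub_le x x' y
  have h2 := abs_geoDist_sub_le_right y y' x'
  calc _ = |(geoDist x y - geoDist x' y) + (geoDist x' y - geoDist x' y')| := by ring_nf
    _ ≤ _ := (abs_add_le _ _).trans (by linarith)

theorem geoDist_orthAct (Q : ℂ ≃ₗᵢ[ℝ] ℂ) (x y : Circle) :
    geoDist (orthAct Q x) (orthAct Q y) = geoDist x y :=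
  Q.toLinearIsometry.angle_map _ _

theorem orthAct_trans (Q R : ℂ ≃ₗᵢ[ℝ] ℂ) (x : Circle) :
    orthAct (Q.trans R) x = orthAct R (orthAct Q x) := rfl

theorem orthAct_symm_apply (Q : ℂ ≃ₗᵢ[ℝ] ℂ) (x : Circle) : orthAct Q (orthAct Q.symm x) = x := by
  ext; simp [orthAct]

theorem orthAct_rotation (c x : Circle) : orthAct (rotation c) x = c * x := by
  ext; simp [orthAct]

theorem orthAct_conj (x : Circle) : orthAct Complex.conjLIE x = x⁻¹ := by
  ext; rw [Circle.coe_inv_eq_conj]; simp [orthAct]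

theorem geoDist_mul_left (c x y : Circle) : geoDist (c * x) (c * y) = geoDist x y := by
  rw [← orthAct_rotation, ← orthAct_rotation, geoDist_orthAct]

theorem geoDist_inv (x y : Circle) : geoDist x⁻¹ y⁻¹ = geoDist x y := by
  rw [← orthAct_conj, ← orthAct_conj, geoDist_orthAct]

theorem geoDist_exp_exp (s t : ℝ) :
    geoDist (Circle.exp s) (Circle.exp t) = |toIocMod Real.two_pi_pos (-Real.pi) (s - t)| := by
  rw [geoDist, Circle.coe_exp, Circle.coe_exp, Complex.angle_exp_exp]

theorem geoDist_exp_of_abs_le {s t : ℝ} (h : |s - t| ≤ Real.pi) :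
    geoDist (Circle.exp s) (Circle.exp t) = |s - t| := by
  rw [geoDist_exp_exp]
  have hp := pi_pos
  -- The value `s - t = -π` falls outside the half-open interval; its representative is `π`, with
  -- the same absolute value.
  rcases eq_or_lt_of_le (abs_le.1 h).1 with h1 | h1
  · rw [← h1]
    have : toIocMod Real.two_pi_pos (-Real.pi) (-Real.pi) = Real.pi := by
      rw [toIocMod_apply_left]; ring
    rw [this, abs_neg]
  · rw [(toIocMod_eq_self Real.two_pi_pos).2 ⟨h1, by linarith [(abs_le.1 h).2]⟩]

theorem geoDist_exp_le (s t : ℝ) : geoDist (Circle.exp s) (Circle.exp t) ≤ |s - t| := by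
  rcases le_total |s - t| Real.pi with h | h
  · exact (geoDist_exp_of_abs_le h).le
  · exact (geoDist_le_pi _ _).trans h

theorem geoDist_exp_of_pi_le_abs {s t : ℝ} (h : Real.pi ≤ |s - t|) (h' : |s - t| ≤ 2 * Real.pi) :
    geoDist (Circle.exp s) (Circle.exp t) = 2 * Real.pi - |s - t| := by
  wlog hst : t ≤ s generalizing s t
  · rw [geoDist_comm, abs_sub_comm]
    rw [abs_sub_comm] at h h'
    exact this h h' (le_of_not_ge hst)
  rw [abs_of_nonneg (sub_nonneg.2 hst)] at *
  have : Circle.exp s = Circle.exp (s - 2 * Real.pi) := (Circle.exp_sub_two_pi s).symm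
  rw [this, geoDist_exp_of_abs_le]
  · rw [abs_of_nonpos (by linarith)]; ring
  · rw [abs_of_nonpos (by linarith)]; linarith

/-- Up to reflection through the line of `a`, the distances to `a` determine the position. -/
theorem geoDist_mirror (a x y : Circle) :
    geoDist x y ≤ |geoDist a x - geoDist a y| ∨
      geoDist x (a * a * y⁻¹) ≤ |geoDist a x - geoDist a y| := by
  obtain ⟨s, hs, rfl⟩ : ∃ s, |s| ≤ Real.pi ∧ x = a * Circle.exp s :=
    ⟨Complex.arg (a⁻¹ * x : Circle), Complex.abs_arg_le_pi _, by rw [Circle.exp_arg]; group⟩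
  obtain ⟨t, ht, rfl⟩ : ∃ s, |s| ≤ Real.pi ∧ y = a * Circle.exp s :=
    ⟨Complex.arg (a⁻¹ * y : Circle), Complex.abs_arg_le_pi _, by rw [Circle.exp_arg]; group⟩
  have e1 : ∀ s : ℝ, |s| ≤ Real.pi → geoDist a (a * Circle.exp s) = |s| := fun s hs => by
    nth_rw 1 [← mul_one a]
    rw [geoDist_mul_left, ← Circle.exp_zero, geoDist_exp_of_abs_le (by simpa using hs)]
    simp
  have e2 : a * a * (a * Circle.exp t)⁻¹ = a * Circle.exp (-t) := by
    rw [Circle.exp_neg, mul_inv_rev, mul_assoc, mul_comm (Circle.exp t)⁻¹, mul_inv_cancel_left]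
  rw [e1 s hs, e1 t ht, e2, geoDist_mul_left, geoDist_mul_left]
  have h1 := geoDist_exp_le s t
  have h2 := geoDist_exp_le s (-t)
  rw [sub_neg_eq_add] at h2
  -- The distances to `a` are `|s|` and `|t|`, and the mirror image negates `t`: equal signs give
  -- the first alternative, opposite signs the second.
  rcases le_total 0 s with h | h <;> rcases le_total 0 t with h' | h'
  · left; rwa [abs_of_nonneg h, abs_of_nonneg h']
  · right; rwa [abs_of_nonneg h, abs_of_nonpos h', sub_neg_eq_add]
  · right; rwa [abs_of_nonpos h, abs_of_nonneg h', ← abs_neg, neg_sub, sub_neg_eq_add, add_comm t]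
  · left; rwa [abs_of_nonpos h, abs_of_nonpos h', ← abs_neg, neg_sub, sub_neg_eq_add, neg_add_eq_sub]

/-- The map `y ↦ a * a * y⁻¹` is the reflection in the line of `a`, an isometry that fixes `a`. -/
theorem geoDist_mirror_self (a y : Circle) : geoDist a (a * a * y⁻¹) = geoDist a y := by
  have h : geoDist (a⁻¹ * a) (a⁻¹ * (a * a * y⁻¹)) = geoDist (y * (y⁻¹)) (y * a⁻¹) := by
    simp only [mul_assoc, inv_mul_cancel, inv_mul_cancel_left, mul_inv_cancel]
    rw [mul_comm, mul_comm y]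
    have := geoDist_inv 1 (a⁻¹ * y)
    rw [← this]; simp [mul_comm]
  rw [geoDist_mul_left, geoDist_mul_left, geoDist_inv] at h
  rw [h, geoDist_comm]

/-- A pair of points can be sent close to any other pair with almost the same distance. -/
theorem exists_orthAct_eq (a b a' b' : Circle) :
    ∃ Q : ℂ ≃ₗᵢ[ℝ] ℂ, orthAct Q a = a' ∧
      geoDist b' (orthAct Q b) ≤ |geoDist a' b' - geoDist a b| := by
  have h := geoDist_mirror a' b' (a' * a⁻¹ * b)
  have e : geoDist a' (a' * a⁻¹ * b) = geoDist a b := by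
    rw [mul_assoc]; nth_rw 1 [← mul_one a']
    rw [geoDist_mul_left, ← geoDist_mul_left a, mul_inv_cancel_left, mul_one]
  rw [e] at h
  rcases h with h | h
  · exact ⟨rotation (a' * a⁻¹), by rw [orthAct_rotation, inv_mul_cancel_right],
      by rwa [orthAct_rotation]⟩
  -- The rotation that carries `a` to `a'`, followed by the reflection in the line of `a'`.
  · refine ⟨Complex.conjLIE.trans (rotation (a' * a)), ?_, ?_⟩
    · rw [orthAct_trans, orthAct_conj, orthAct_rotation, mul_inv_cancel_right]
    · rw [orthAct_trans, orthAct_conj, orthAct_rotation]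
      convert h using 2
      ext
      have h1 := Circle.coe_ne_zero a
      have h2 := Circle.coe_ne_zero b
      have h3 := Circle.coe_ne_zero a'
      push_cast
      field_simp

/-! ### Angles, inner products and chords. -/

theorem cos_geoDist (x y : Circle) : Real.cos (geoDist x y) = inner ℝ (x : ℂ) (y : ℂ) := by
  rw [geoDist, InnerProductGeometry.cos_angle, Circle.norm_coe, Circle.norm_coe]; simp

/-- The cosine is 1-Lipschitz. This transfers control of distances to inner products, where linear
algebra applies. -/
theorem abs_inner_sub_inner_le (x y x' y' : Circle) :
    |inner ℝ (x : ℂ) (y : ℂ) - inner ℝ (x' : ℂ) (y' : ℂ)| ≤ |geoDist x y - geoDist x' y'| := by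
  rw [← cos_geoDist, ← cos_geoDist]; exact Real.abs_cos_sub_cos_le _ _

theorem circle_norm_sub_sq (x y : Circle) : ‖(x : ℂ) - y‖ ^ 2 = 2 - 2 * Real.cos (geoDist x y) := by
  rw [norm_sub_sq_real, cos_geoDist, Circle.norm_coe, Circle.norm_coe]; ring

/-- An arc is at most `π / 2` times its chord, by `1 - cos θ ≥ 2θ² / π²` on `[-π, π]`. -/
theorem geoDist_sq_le (x y : Circle) : geoDist x y ^ 2 ≤ Real.pi ^ 2 / 4 * ‖(x : ℂ) - y‖ ^ 2 := by
  rw [circle_norm_sub_sq]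
  have := Real.cos_le_one_sub_mul_cos_sq (x := geoDist x y)
    (by rw [abs_of_nonneg (geoDist_nonneg x y)]; exact geoDist_le_pi x y)
  have hp : 0 < Real.pi ^ 2 := by positivity
  have h2 : 2 / Real.pi ^ 2 * geoDist x y ^ 2 ≤ 1 - Real.cos (geoDist x y) := by linarith
  calc geoDist x y ^ 2 = Real.pi ^ 2 / 2 * (2 / Real.pi ^ 2 * geoDist x y ^ 2) := by field_simp
    _ ≤ Real.pi ^ 2 / 2 * (1 - Real.cos (geoDist x y)) := by gcongr
    _ = _ := by ring

/-- Two unit vectors with a positive angle control the norm. -/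
theorem norm_sq_mul_sin_sq_le (v : ℂ) (a b : Circle) :
    ‖v‖ ^ 2 * (1 - (inner ℝ (a : ℂ) (b : ℂ)) ^ 2) ≤
      2 * ((inner ℝ v (a : ℂ)) ^ 2 + (inner ℝ v (b : ℂ)) ^ 2) := by
  have ha : (a : ℂ).re ^ 2 + (a : ℂ).im ^ 2 = 1 := by
    have := Circle.normSq_coe a; rw [Complex.normSq_apply] at this; linarith
  have hb : (b : ℂ).re ^ 2 + (b : ℂ).im ^ 2 = 1 := by
    have := Circle.normSq_coe b; rw [Complex.normSq_apply] at this; linarith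
  rw [← Complex.normSq_eq_norm_sq, Complex.normSq_apply]
  simp only [Complex.inner, Complex.mul_re, Complex.conj_re, Complex.conj_im]
  generalize (a : ℂ).re = p at *
  generalize (a : ℂ).im = q at *
  generalize (b : ℂ).re = r at *
  generalize (b : ℂ).im = s at *
  generalize v.re = x
  generalize v.im = y
  obtain ⟨c, hc⟩ : ∃ c, c = p * r + q * s := ⟨_, rfl⟩
  obtain ⟨A, hA⟩ : ∃ A, A = p * x + q * y := ⟨_, rfl⟩
  obtain ⟨B, hB⟩ : ∃ B, B = r * x + s * y := ⟨_, rfl⟩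
  -- Here `1 - c ^ 2` is the squared determinant of the two unit vectors, and Cramer's rule gives
  -- `h2`. The cross term `-2 * A * B * c` is at most `A ^ 2 + B ^ 2`, because `(A + c * B) ^ 2 + (1
  -- - c ^ 2) * B ^ 2 ≥ 0`.
  have h1 : 1 - c ^ 2 = (p * s - q * r) ^ 2 := by
    rw [hc]; linear_combination (-(r ^ 2 + s ^ 2)) * ha - hb
  have h2 : (x ^ 2 + y ^ 2) * (p * s - q * r) ^ 2 =
      A ^ 2 * (r ^ 2 + s ^ 2) + B ^ 2 * (p ^ 2 + q ^ 2) - 2 * A * B * c := by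
    rw [hA, hB, hc]; ring
  have h3 : (r * p - s * -q) = c := by rw [hc]; ring
  have h4 : (p * x - q * -y) = A := by rw [hA]; ring
  have h5 : (r * x - s * -y) = B := by rw [hB]; ring
  rw [h3, h4, h5, h1]
  rw [ha, hb] at h2
  have h6 : 0 ≤ (p * s - q * r) ^ 2 * B ^ 2 := by positivity
  rw [← h1] at h6
  nlinarith [sq_nonneg (A + c * B)]

/-! ### Regular grids: distances, rounding and trigonometric sums. -/

/-- The point `exp(2πι m / k)`, for an integer `m`. -/
noncomputable def torusPoint (k : ℕ) (m : ℤ) : Circle := Circle.exp (2 * Real.pi * m / k)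

theorem gridPoint_eq_torusPoint (k : ℕ) (j : Fin k) : gridPoint k j = torusPoint k (j : ℤ) := by
  simp [gridPoint, torusPoint]

theorem torusPoint_add (k : ℕ) (a b : ℤ) :
    torusPoint k (a + b) = torusPoint k a * torusPoint k b := by
  rw [torusPoint, torusPoint, torusPoint, ← Circle.exp_add]
  congr 1; push_cast; ring

theorem torusPoint_neg (k : ℕ) (a : ℤ) : torusPoint k (-a) = (torusPoint k a)⁻¹ := by
  rw [torusPoint, torusPoint, ← Circle.exp_neg]
  congr 1; push_cast; ring

theorem torusPoint_mul_self (k : ℕ) (m : ℤ) : torusPoint k (k * m) = 1 := by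
  rcases eq_or_ne k 0 with rfl | hk
  · simp [torusPoint]
  · rw [torusPoint, show 2 * Real.pi * ((k * m : ℤ) : ℝ) / k = m * (2 * Real.pi) by
      push_cast; field_simp]
    exact Circle.exp_int_mul_two_pi m

theorem torusPoint_emod (k : ℕ) (m : ℤ) : torusPoint k (m % k) = torusPoint k m := by
  conv_rhs => rw [← Int.emod_add_mul_ediv m k, torusPoint_add, torusPoint_mul_self, mul_one]

theorem torusPoint_eq_of_modEq {k : ℕ} {a b : ℤ} (h : a ≡ b [ZMOD k]) :
    torusPoint k a = torusPoint k b := by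
  rw [← torusPoint_emod k a, ← torusPoint_emod k b, h]

theorem geoDist_torusPoint {n : ℕ} (hn : 0 < n) {a b : ℤ} (h : |a - b| ≤ n) :
    geoDist (torusPoint n a) (torusPoint n b) = 2 * Real.pi / n * torusDist n a b := by
  have hn' : (0 : ℝ) < n := by exact_mod_cast hn
  have hp := pi_pos
  have e : 2 * Real.pi * a / n - 2 * Real.pi * b / n = 2 * Real.pi / n * (a - b) := by ring
  have e' : |2 * Real.pi * a / n - 2 * Real.pi * b / n| = 2 * Real.pi / n * |((a - b : ℤ) : ℝ)| := by
    rw [e, abs_mul, abs_of_pos (by positivity)]; push_cast; rfl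
  have h' : |((a - b : ℤ) : ℝ)| ≤ n := by rw [← Int.cast_abs]; exact_mod_cast h
  have e3 : 2 * Real.pi / n * n = 2 * Real.pi := by field_simp
  rw [torusPoint, torusPoint, torusDist]
  push_cast at h' e' ⊢
  rcases le_total (2 * |(a : ℝ) - b|) n with h2 | h2
  · rw [geoDist_exp_of_abs_le, e', min_eq_left (by linarith)]
    rw [e']
    calc _ = Real.pi / n * (2 * |(a : ℝ) - b|) := by ring
      _ ≤ Real.pi / n * n := by gcongr
      _ = _ := by field_simp
  · rw [geoDist_exp_of_pi_le_abs, e', min_eq_right (by linarith), mul_sub, e3]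
    · rw [e']
      calc Real.pi = Real.pi / n * n := by field_simp
        _ ≤ Real.pi / n * (2 * |(a : ℝ) - b|) := by gcongr
        _ = _ := by ring
    · rw [e']
      calc _ ≤ 2 * Real.pi / n * n := by gcongr
        _ = _ := e3

theorem exists_torusPoint_near {k : ℕ} (hk : 0 < k) (v : Circle) :
    ∃ m : ℤ, geoDist v (torusPoint k m) ≤ Real.pi / k := by
  have hk' : (0 : ℝ) < k := by exact_mod_cast hk
  have hp := pi_pos
  refine ⟨round (Complex.arg v * k / (2 * Real.pi)), ?_⟩
  nth_rw 1 [← Circle.exp_arg v]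
  refine (geoDist_exp_le _ _).trans ?_
  have := abs_sub_round (Complex.arg v * k / (2 * Real.pi))
  set m := round (Complex.arg v * k / (2 * Real.pi))
  have e : Complex.arg v - 2 * Real.pi * m / k =
      2 * Real.pi / k * (Complex.arg v * k / (2 * Real.pi) - m) := by field_simp
  rw [e, abs_mul, abs_of_pos (by positivity)]
  calc _ ≤ 2 * Real.pi / k * (1 / 2) := by gcongr
    _ = _ := by ring

theorem exists_fin_torusPoint_eq {k : ℕ} (hk : 0 < k) (m : ℤ) :
    ∃ j : Fin k, torusPoint k (j : ℤ) = torusPoint k m := by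
  have h0 : 0 ≤ m % k := Int.emod_nonneg _ (by omega)
  have h1 : m % k < k := Int.emod_lt_of_pos _ (by omega)
  refine ⟨⟨(m % k).toNat, by omega⟩, ?_⟩
  rw [← torusPoint_emod k m]
  congr 1
  simp [h0]

theorem exists_gridPoint_near {k : ℕ} (hk : 0 < k) (v : Circle) :
    ∃ j : Fin k, geoDist v (gridPoint k j) ≤ Real.pi / k := by
  obtain ⟨m, hm⟩ := exists_torusPoint_near hk v
  obtain ⟨j, hj⟩ := exists_fin_torusPoint_eq hk m
  exact ⟨j, by rwa [gridPoint_eq_torusPoint, hj]⟩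

theorem exists_label_eq {n : ℕ} (hn : 0 < n) (m : ℤ) :
    ∃ j : Fin n, torusPoint n (label j) = torusPoint n m := by
  obtain ⟨j, hj⟩ := exists_fin_torusPoint_eq hn (m - 1)
  refine ⟨j, ?_⟩
  rw [label, torusPoint_add, hj, ← torusPoint_add, sub_add_cancel]

/-- By rotation invariance, any two rows of the distance matrix of the grid differ by a cyclic
shift. This supplies the permutation required by the rearrangement inequality. -/
theorem geoDist_gridPoint_shift {k : ℕ} [NeZero k] (p q j : Fin k) :
    geoDist (gridPoint k q) (gridPoint k j) =
      geoDist (gridPoint k p) (gridPoint k (j + (p - q))) := by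
  have e : ∀ a b : Fin k, gridPoint k (a + b) = gridPoint k a * gridPoint k b := fun a b => by
    rw [gridPoint_eq_torusPoint, gridPoint_eq_torusPoint, gridPoint_eq_torusPoint,
      ← torusPoint_add]
    refine torusPoint_eq_of_modEq ?_
    rw [Fin.val_add]; push_cast
    exact Int.mod_modEq _ _
  obtain ⟨r, rfl⟩ : ∃ r, p = q + r := ⟨p - q, by abel⟩
  rw [add_sub_cancel_left]
  rw [e, e, mul_comm, mul_comm (gridPoint k j), geoDist_mul_left]

/-- A geometric sum whose ratio is a `k`-th root of unity different from 1. -/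
theorem sum_gridPoint_pow {k m : ℕ} (h0 : 0 < m) (hm : m < k) :
    ∑ j : Fin k, (gridPoint k j : ℂ) ^ m = 0 := by
  have hk : k ≠ 0 := by omega
  have hζ := Complex.isPrimitiveRoot_exp k hk
  set ζ := Complex.exp (2 * Real.pi * Complex.I / k)
  have e : ∀ j : Fin k, (gridPoint k j : ℂ) ^ m = (ζ ^ m) ^ (j : ℕ) := fun j => by
    rw [← pow_mul, mul_comm m, pow_mul]
    congr 1
    rw [gridPoint, Circle.coe_exp, ← Complex.exp_nat_mul]
    congr 1; push_cast; ring
  rw [Finset.sum_congr rfl fun j _ => e j, Fin.sum_univ_eq_sum_range (fun j => (ζ ^ m) ^ j) k]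
  have h1 : ζ ^ m ≠ 1 := hζ.pow_ne_one_of_pos_of_lt h0.ne' hm
  have := geom_sum_mul (ζ ^ m) k
  rw [← pow_mul, mul_comm m, pow_mul, hζ.pow_eq_one, one_pow, sub_self] at this
  exact (mul_eq_zero.1 this).resolve_right (sub_ne_zero.2 h1)

/-- The points of a rotated grid form a tight frame. -/
theorem sum_inner_gridPoint_sq {k : ℕ} (hk : 3 ≤ k) (v : ℂ) (c : Circle) :
    ∑ j : Fin k, (inner ℝ v ((c * gridPoint k j : Circle) : ℂ)) ^ 2 = k / 2 * ‖v‖ ^ 2 := by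
  -- A squared cosine is one half plus a second harmonic, which sums to zero over the grid as soon
  -- as `2 < k`.
  have e : ∀ j : Fin k, (inner ℝ v ((c * gridPoint k j : Circle) : ℂ)) ^ 2 = ‖v‖ ^ 2 / 2 +
      ((c * (starRingEnd ℂ) v) ^ 2 / 2 * (gridPoint k j : ℂ) ^ 2).re := fun j => by
    have h : ‖v‖ ^ 2 = ‖(c * gridPoint k j : Circle) * (starRingEnd ℂ) v‖ ^ 2 := by
      rw [norm_mul, Circle.norm_coe, RCLike.norm_conj, one_mul]
    rw [h, Complex.inner, show (c * (starRingEnd ℂ) v) ^ 2 / 2 * (gridPoint k j : ℂ) ^ 2 =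
      (((c * gridPoint k j : Circle) : ℂ) * (starRingEnd ℂ) v) ^ 2 * ((1 / 2 : ℝ) : ℂ) by push_cast; ring]
    generalize ((c * gridPoint k j : Circle) : ℂ) * (starRingEnd ℂ) v = w
    rw [Complex.re_mul_ofReal, ← Complex.normSq_eq_norm_sq, Complex.normSq_apply, pow_two w,
      Complex.mul_re]
    ring
  rw [Finset.sum_congr rfl fun j _ => e j, Finset.sum_add_distrib, ← Complex.re_sum,
    ← Finset.mul_sum, sum_gridPoint_pow (by norm_num) (by omega)]
  simp; ring

/-- From `cos⁴ θ = 3/8 + cos(2θ)/2 + cos(4θ)/8`, only the constant survives summation. The merging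
step relies on the gap between `3/8` and `1/2`. -/
theorem sum_inner_gridPoint_pow_four {k : ℕ} (hk : 5 ≤ k) (v c : Circle) :
    ∑ j : Fin k, (inner ℝ (v : ℂ) ((c * gridPoint k j : Circle) : ℂ)) ^ 4 = 3 * k / 8 := by
  have e : ∀ j : Fin k, (inner ℝ (v : ℂ) ((c * gridPoint k j : Circle) : ℂ)) ^ 4 = 3 / 8 +
      (((c * v⁻¹ : Circle) : ℂ) ^ 2 / 2 * (gridPoint k j : ℂ) ^ 2).re +
      (((c * v⁻¹ : Circle) : ℂ) ^ 4 / 8 * (gridPoint k j : ℂ) ^ 4).re := fun j => by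
    obtain ⟨w, hw⟩ : ∃ w : Circle, w = c * gridPoint k j * v⁻¹ := ⟨_, rfl⟩
    have h1 : inner ℝ (v : ℂ) ((c * gridPoint k j : Circle) : ℂ) = (w : ℂ).re := by
      rw [Complex.inner, hw, Circle.coe_mul _ v⁻¹, Circle.coe_inv_eq_conj]
    have h2 : ((c * v⁻¹ : Circle) : ℂ) ^ 2 / 2 * (gridPoint k j : ℂ) ^ 2 =
        (w : ℂ) ^ 2 * ((1 / 2 : ℝ) : ℂ) := by rw [hw]; push_cast; ring
    have h3 : ((c * v⁻¹ : Circle) : ℂ) ^ 4 / 8 * (gridPoint k j : ℂ) ^ 4 =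
        ((w : ℂ) ^ 2) ^ 2 * ((1 / 8 : ℝ) : ℂ) := by rw [hw]; push_cast; ring
    have h4 : (w : ℂ).im ^ 2 = 1 - (w : ℂ).re ^ 2 := by
      have := Circle.normSq_coe w; rw [Complex.normSq_apply] at this; linarith
    rw [h1, h2, h3, Complex.re_mul_ofReal, Complex.re_mul_ofReal, pow_two ((w : ℂ) ^ 2),
      pow_two (w : ℂ)]
    simp only [Complex.mul_re, Complex.mul_im]
    generalize (w : ℂ).re = p at *
    generalize (w : ℂ).im = q at *
    have h5 : q ^ 4 = (1 - p ^ 2) ^ 2 := by rw [← h4]; ring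
    linear_combination (1 / 2 + 6 / 8 * p ^ 2 ) * h4 - 1 / 8 * h5
  rw [Finset.sum_congr rfl fun j _ => e j, Finset.sum_add_distrib, Finset.sum_add_distrib,
    ← Complex.re_sum, ← Complex.re_sum, ← Finset.mul_sum, ← Finset.mul_sum,
    sum_gridPoint_pow (by norm_num) (by omega), sum_gridPoint_pow (by norm_num) (by omega)]
  simp; ring

theorem geoDist_torusPoint_sigmaHat {n : ℕ} (x : Fin n → Circle) (i : Fin n) :
    geoDist (x i) (torusPoint n (sigmaHat x i)) ≤ 2 * Real.pi / n := by
  have hn : (0 : ℝ) < n := by exact_mod_cast i.pos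
  have hp := Real.two_pi_pos
  have e : x i = Circle.exp (argPos (x i)) := by
    rw [argPos, toIocMod, zsmul_eq_mul, Circle.exp_sub, Circle.exp_int_mul_two_pi, div_one,
      Circle.exp_arg]
  nth_rw 1 [e]
  refine (geoDist_exp_le _ _).trans ?_
  have h1 := Int.le_ceil ((n : ℝ) * argPos (x i) / (2 * Real.pi))
  have h2 := (Int.ceil_lt_add_one ((n : ℝ) * argPos (x i) / (2 * Real.pi))).le
  have e2 : argPos (x i) - 2 * Real.pi * (sigmaHat x i : ℝ) / n =
      2 * Real.pi / n * ((n : ℝ) * argPos (x i) / (2 * Real.pi) - sigmaHat x i) := by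
    field_simp
  rw [e2, abs_mul, abs_of_pos (by positivity)]
  have : |(n : ℝ) * argPos (x i) / (2 * Real.pi) - sigmaHat x i| ≤ 1 := by
    rw [sigmaHat, abs_le]; constructor <;> linarith
  calc _ ≤ 2 * Real.pi / n * 1 := by gcongr
    _ = _ := mul_one _

/-! ### Rearrangement and the deterministic analysis of localization. -/

/-- A quantitative rearrangement inequality: if `f` decreases at least linearly in `a`, up to `η`,
then permuting `a` increases its correlation with `f`. -/
theorem rearrangement_quadratic {Y : Type*} [Fintype Y] (f a b : Y → ℝ) {c η : ℝ}
    (π : Equiv.Perm Y) (hb : ∀ y, b y = a (π y))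
    (h : ∀ j k, a k ≤ a j → c * (a j - a k) - η ≤ f k - f j) :
    c / 2 * ∑ y, (b y - a y) ^ 2 - η * ∑ y, |b y - a y| ≤ ∑ y, f y * (b y - a y) := by
  have hne : ∀ y, (Finset.univ.filter fun y' => a y ≤ a y').Nonempty := fun y => ⟨y, by simp⟩
  -- The least function above `f + c * a` that is nonincreasing in `a`; by `h` it exceeds `f + c *
  -- a` by at most `η`. The classical rearrangement inequality applies to `g`.
  let g : Y → ℝ := fun y => (Finset.univ.filter fun y' => a y ≤ a y').sup' (hne y)
    fun y' => f y' + c * a y'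
  have g1 : ∀ y, f y + c * a y ≤ g y := fun y =>
    Finset.le_sup' (fun y' => f y' + c * a y') (by simp)
  have g2 : ∀ y, g y ≤ f y + c * a y + η := fun y => by
    refine Finset.sup'_le _ _ fun y' hy' => ?_
    have := h y' y (by simpa using hy')
    linarith
  have hanti : Antivary g a := fun i j hij => by
    refine Finset.sup'_mono _ (fun y hy => ?_) _
    simp only [Finset.mem_filter, Finset.mem_univ, true_and] at hy ⊢
    linarith
  have h1 : ∑ y, g y * a y ≤ ∑ y, g y * b y := by
    simpa only [hb] using hanti.sum_mul_le_sum_mul_comp_perm (σ := π)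
  have h2 : ∑ y, b y ^ 2 = ∑ y, a y ^ 2 := by
    simpa only [hb] using Equiv.sum_comp π fun y => a y ^ 2
  -- Since `a` and `b` have the same sum of squares, the linear term `-c * a` left in `f` becomes
  -- the quadratic gain.
  have h3 : ∑ y, (b y - a y) ^ 2 = -2 * ∑ y, a y * (b y - a y) := by
    have : ∀ y, (b y - a y) ^ 2 = (b y ^ 2 - a y ^ 2) + -2 * (a y * (b y - a y)) := fun y => by ring
    rw [Finset.sum_congr rfl fun y _ => this y, Finset.sum_add_distrib, Finset.sum_sub_distrib, h2,
      ← Finset.mul_sum]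
    ring
  have h4 : ∑ y, g y * (b y - a y) - η * ∑ y, |b y - a y| ≤
      ∑ y, f y * (b y - a y) + c * ∑ y, a y * (b y - a y) := by
    rw [Finset.mul_sum, Finset.mul_sum, ← Finset.sum_sub_distrib, ← Finset.sum_add_distrib]
    refine Finset.sum_le_sum fun y _ => ?_
    have : (g y - (f y + c * a y)) * (b y - a y) ≤ η * |b y - a y| := by
      refine (le_abs_self _).trans ?_
      rw [abs_mul]
      gcongr
      rw [abs_of_nonneg (by linarith [g1 y])]; linarith [g2 y]
    nlinarith
  have h5 : 0 ≤ ∑ y, g y * (b y - a y) := by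
    simp only [mul_sub, Finset.sum_sub_distrib]; linarith
  rw [h3]; linarith

/-- The bi-Lipschitz condition, in terms of the latent positions `u i` on the circle, which
are dense at scale `π / n` and symmetric with respect to each of them. -/
structure CircleBiLipschitz {n : ℕ} (cl cL ε : ℝ) (F : Matrix (Fin n) (Fin n) ℝ)
    (u : Fin n → Circle) : Prop where
  upper : ∀ i j k, |F i j - F i k| ≤ cL * geoDist (u j) (u k) + ε
  lower : ∀ i j k, geoDist (u i) (u k) ≤ geoDist (u i) (u j) →
    cl * (geoDist (u i) (u j) - geoDist (u i) (u k)) - ε ≤ F i k - F i j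
  mirror : ∀ i k, ∃ k', u k' = u i * u i * (u k)⁻¹
  dense : ∀ v, ∃ k, geoDist v (u k) ≤ Real.pi / n

/-- A transfer of the lower condition to approximate distances `a`, `b`. If the true distances are
ordered like `a` and `b`, the condition applies directly. Otherwise they differ by at most `2 * s`,
so `u j` is close to `u k` or to its mirror image `u k'`. The upper condition handles the first
case; in the second, the lower condition at equal distances compares `k'` with `k`, at the price of
a second `ε`. -/
theorem CircleBiLipschitz.decrease {n : ℕ} {cl cL ε : ℝ} {F : Matrix (Fin n) (Fin n) ℝ}
    {u : Fin n → Circle} (h : CircleBiLipschitz cl cL ε F u) (hcl : 0 ≤ cl) (hcL : 0 ≤ cL)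
    (hε : 0 ≤ ε) {i j k : Fin n} {a b s : ℝ} (hab : b ≤ a)
    (ha : |a - geoDist (u i) (u j)| ≤ s) (hb : |b - geoDist (u i) (u k)| ≤ s) :
    cl * (a - b) - (2 * (cl + cL) * s + 2 * ε) ≤ F i k - F i j := by
  have hs : 0 ≤ s := (abs_nonneg _).trans ha
  have hs1 : 0 ≤ cl * s := by positivity
  have hs2 : 0 ≤ cL * s := by positivity
  rw [abs_le] at ha hb
  rcases le_total (geoDist (u i) (u k)) (geoDist (u i) (u j)) with hd | hd
  · have h1 := h.lower i j k hd
    have h2 : cl * (a - b) ≤ cl * (geoDist (u i) (u j) - geoDist (u i) (u k) + 2 * s) := by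
      gcongr; linarith
    linarith
  · have h2 : cl * (a - b) ≤ cl * (2 * s) := by
      gcongr; linarith
    have h3 : cL * |geoDist (u i) (u j) - geoDist (u i) (u k)| ≤ cL * (2 * s) := by
      gcongr
      rw [abs_of_nonpos (by linarith)]; linarith
    obtain ⟨k', hk'⟩ := h.mirror i k
    rcases geoDist_mirror (u i) (u j) (u k) with hm | hm
    · have h4 := h.upper i j k
      have h5 := mul_le_mul_of_nonneg_left hm hcL
      have h6 := le_abs_self (F i j - F i k)
      linarith
    · rw [← hk'] at hm
      have h4 := h.upper i j k'
      have h5 := mul_le_mul_of_nonneg_left hm hcL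
      have h6 := le_abs_self (F i j - F i k')
      have e : geoDist (u i) (u k') = geoDist (u i) (u k) := by rw [hk', geoDist_mirror_self]
      have h7 := h.lower i k' k e.ge
      rw [e, sub_self, mul_zero] at h7
      linarith

/-- The deterministic analysis of the initial localization. -/
theorem init_localization {n k : ℕ} [NeZero k] {cl cL ε δ ν : ℝ} {F : Matrix (Fin n) (Fin n) ℝ}
    {u : Fin n → Circle} (h : CircleBiLipschitz cl cL ε F u) (hcl : 0 < cl) (hcL : 0 ≤ cL)
    (hε : 0 ≤ ε) (hδ0 : 0 ≤ δ) (hν : 0 ≤ ν) {T : Finset (Fin n)} (e₀ e : T ≃ Fin k)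
    (hδ : ∀ j, geoDist (gridPoint k (e₀ j)) (u j) ≤ δ) (W : T → T → ℝ)
    (hmin : ∑ i : T, ∑ j : T, (F i j + W i j) * geoDist (gridPoint k (e i)) (gridPoint k (e j)) ≤
      ∑ i : T, ∑ j : T, (F i j + W i j) * geoDist (gridPoint k (e₀ i)) (gridPoint k (e₀ j)))
    (hW : ∑ i, ∑ j, W i j * (geoDist (gridPoint k (e₀ i)) (gridPoint k (e₀ j)) -
        geoDist (gridPoint k (e i)) (gridPoint k (e j))) ≤
      ν * √(∑ i, ∑ j, (geoDist (gridPoint k (e₀ i)) (gridPoint k (e₀ j)) -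
        geoDist (gridPoint k (e i)) (gridPoint k (e j))) ^ 2)) :
    ∑ i, ∑ j, (geoDist (gridPoint k (e i)) (gridPoint k (e j)) -
      geoDist (gridPoint k (e₀ i)) (gridPoint k (e₀ j))) ^ 2 ≤
        (2 / cl * (ν + k * (4 * (cl + cL) * δ + 2 * ε))) ^ 2 := by
  set η := 4 * (cl + cL) * δ + 2 * ε with hη
  have hη0 : 0 ≤ η := by positivity
  let Δ : T → T → ℝ := fun i j => geoDist (gridPoint k (e i)) (gridPoint k (e j)) -
      geoDist (gridPoint k (e₀ i)) (gridPoint k (e₀ j))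
  have hrow : ∀ i : T, cl / 2 * ∑ j, Δ i j ^ 2 - η * ∑ j, |Δ i j| ≤ ∑ j : T, F i j * Δ i j := by
    intro i
    refine rearrangement_quadratic (fun j : T => F i j)
      (fun j => geoDist (gridPoint k (e₀ i)) (gridPoint k (e₀ j)))
      (fun j => geoDist (gridPoint k (e i)) (gridPoint k (e j)))
      -- Both rows list the distances from one grid point to the whole grid, so a shift matches
      -- them.
      ((e.trans (Equiv.addRight (e₀ i - e i))).trans e₀.symm) (fun j => ?_) (fun j j' hjj => ?_)
    · simpa using geoDist_gridPoint_shift (e₀ i) (e i) (e j)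
    · have := h.decrease hcl.le hcL hε (i := i) (j := j) (k := j') (s := 2 * δ) hjj
        ((abs_geoDist_sub_geoDist_le _ _ _ _).trans (by linarith [hδ i, hδ j]))
        ((abs_geoDist_sub_geoDist_le _ _ _ _).trans (by linarith [hδ i, hδ j']))
      refine le_trans (le_of_eq ?_) this
      rw [hη]; ring
  have hΦ : ∑ i, ∑ j, (geoDist (gridPoint k (e₀ i)) (gridPoint k (e₀ j)) -
        geoDist (gridPoint k (e i)) (gridPoint k (e j))) ^ 2 = ∑ i, ∑ j, Δ i j ^ 2 :=
    Finset.sum_congr rfl fun i _ => Finset.sum_congr rfl fun j _ => by simp only [Δ]; ring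
  rw [hΦ] at hW
  set Φ := ∑ i, ∑ j, Δ i j ^ 2 with hΦdef
  have hΦ0 : 0 ≤ Φ := Finset.sum_nonneg fun i _ => Finset.sum_nonneg fun j _ => sq_nonneg _
  have hsum : cl / 2 * Φ - η * ∑ i, ∑ j, |Δ i j| ≤ ∑ i : T, ∑ j : T, F i j * Δ i j := by
    rw [hΦdef, Finset.mul_sum, Finset.mul_sum, ← Finset.sum_sub_distrib]
    exact Finset.sum_le_sum fun i _ => hrow i
  -- Optimality of `e` against the oracle `e₀` leaves only the noise form.
  have hF : ∑ i : T, ∑ j : T, F i j * Δ i j ≤ ν * √Φ := by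
    refine le_trans ?_ hW
    rw [← sub_nonneg] at hmin ⊢
    refine hmin.trans (le_of_eq ?_)
    rw [← Finset.sum_sub_distrib, ← Finset.sum_sub_distrib]
    refine Finset.sum_congr rfl fun i _ => ?_
    rw [← Finset.sum_sub_distrib, ← Finset.sum_sub_distrib]
    refine Finset.sum_congr rfl fun j _ => ?_
    simp only [Δ]; ring
  have hk : Fintype.card T = k := by simpa using Fintype.card_congr e
  have hL1 : ∑ i, ∑ j, |Δ i j| ≤ k * √Φ := by
    have h1 := sq_sum_le_card_mul_sum_sq (s := (Finset.univ : Finset (T × T)))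
      (f := fun p => |Δ p.1 p.2|)
    rw [Fintype.sum_prod_type, Fintype.sum_prod_type, Finset.card_univ, Fintype.card_prod, hk] at h1
    simp only [sq_abs] at h1
    refine abs_le_of_sq_le_sq' ?_ (by positivity) |>.2
    refine h1.trans (le_of_eq ?_)
    rw [mul_pow, Real.sq_sqrt hΦ0, hΦdef]; push_cast; ring
  have hmain : cl / 2 * Φ ≤ (ν + k * η) * √Φ := by
    have := mul_le_mul_of_nonneg_left hL1 hη0
    linarith
  show Φ ≤ _
  have hr : √Φ ≤ 2 / cl * (ν + k * η) := by
    rcases eq_or_lt_of_le (Real.sqrt_nonneg Φ) with h0 | h0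
    · rw [← h0]; positivity
    · have h1 : cl / 2 * √Φ ≤ ν + k * η := by
        refine le_of_mul_le_mul_right ?_ h0
        rw [mul_assoc, Real.mul_self_sqrt hΦ0]; exact hmain
      calc √Φ = 2 / cl * (cl / 2 * √Φ) := by field_simp
        _ ≤ _ := by gcongr
  calc Φ = √Φ ^ 2 := (Real.sq_sqrt hΦ0).symm
    _ ≤ _ := by gcongr

theorem pi_sq_le_ten : Real.pi ^ 2 ≤ 10 := by
  have h1 := Real.pi_lt_d2
  have h2 := pi_pos
  nlinarith

/-- Two configurations with similar distance matrices are close up to an orthogonal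
transformation. -/
theorem exists_orthAct_sum_sq_le {Y : Type*} [Fintype Y] {k : ℕ} (hk : 0 < k)
    (hY : Fintype.card Y = k) (x z : Y → Circle) {Ψ : ℝ} (hΨ : 0 < Ψ)
    (hframe : ∀ a, ∑ b, (1 - (inner ℝ (z a : ℂ) (z b : ℂ)) ^ 2) = (k : ℝ) / 2)
    (h : ∑ i, ∑ j, (geoDist (x i) (x j) - geoDist (z i) (z j)) ^ 2 ≤ Ψ) :
    ∃ Q : ℂ ≃ₗᵢ[ℝ] ℂ, ∑ j, geoDist (x j) (orthAct Q (z j)) ^ 2 ≤ 60 * Ψ / k := by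
  have hk' : (0 : ℝ) < k := by exact_mod_cast hk
  have : Nonempty Y := Fintype.card_pos_iff.1 (hY ▸ hk)
  let Δ : Y → Y → ℝ := fun i j => geoDist (x i) (x j) - geoDist (z i) (z j)
  have hsymm : ∀ i j, Δ i j = Δ j i := fun i j => by
    simp only [Δ]; rw [geoDist_comm (x i), geoDist_comm (z i)]
  let R : Y → ℝ := fun i => ∑ j, Δ i j ^ 2
  have hR : ∑ i, R i ≤ Ψ := h
  have hR0 : ∀ i, 0 ≤ R i := fun i => Finset.sum_nonneg fun j _ => sq_nonneg _
  obtain ⟨a, -, ha⟩ : ∃ a ∈ Finset.univ, R a ≤ Ψ / k := by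
    refine Finset.exists_le_of_sum_le Finset.univ_nonempty ?_
    rw [Finset.sum_const, Finset.card_univ, hY, nsmul_eq_mul, mul_div_cancel₀ _ hk'.ne']
    exact hR
  rw [le_div_iff₀ hk'] at ha
  -- A second anchor, chosen by averaging with the squared sine of its angle to `a` as weight. The
  -- left sides sum to at most `10 * Ψ`, the right ones to `11 * Ψ` by `hframe`; the strict
  -- inequality also ensures that the angle is not degenerate.
  obtain ⟨b, -, hb⟩ : ∃ b ∈ Finset.univ, 2 * (R a + 2 * R b + 2 * k * Δ a b ^ 2) <
      22 * Ψ / k * (1 - (inner ℝ (z a : ℂ) (z b : ℂ)) ^ 2) := by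
    refine Finset.exists_lt_of_sum_lt ?_
    rw [← Finset.mul_sum, ← Finset.mul_sum, hframe, Finset.sum_add_distrib, Finset.sum_add_distrib,
      ← Finset.mul_sum, ← Finset.mul_sum, Finset.sum_const, Finset.card_univ, hY, nsmul_eq_mul]
    change 2 * (k * R a + 2 * ∑ i, R i + 2 * k * R a) < _
    have : 22 * Ψ / k * (k / 2) = 11 * Ψ := by field_simp; norm_num
    rw [this]; linarith
  -- Once the two anchors are aligned, every other point is controlled through its inner products
  -- with them.
  obtain ⟨Q, hQa, hQb⟩ := exists_orthAct_eq (z a) (z b) (x a) (x b)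
  refine ⟨Q, ?_⟩
  set s := 1 - (inner ℝ (z a : ℂ) (z b : ℂ)) ^ 2 with hs
  have hpt : ∀ j, ‖(x j : ℂ) - orthAct Q (z j)‖ ^ 2 * s ≤
      2 * (Δ a j ^ 2 + 2 * (Δ b j ^ 2 + Δ a b ^ 2)) := by
    intro j
    have h1 := norm_sq_mul_sin_sq_le ((x j : ℂ) - orthAct Q (z j)) (orthAct Q (z a))
      (orthAct Q (z b))
    rw [← cos_geoDist, geoDist_orthAct, cos_geoDist, ← hs] at h1
    refine h1.trans ?_
    have e1 : |inner ℝ ((x j : ℂ) - orthAct Q (z j)) (orthAct Q (z a) : ℂ)| ≤ |Δ a j| := by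
      rw [inner_sub_left]; nth_rw 1 [hQa]
      refine (abs_inner_sub_inner_le _ _ _ _).trans ?_
      rw [geoDist_orthAct, hsymm]
    have e2 : |inner ℝ ((x j : ℂ) - orthAct Q (z j)) (orthAct Q (z b) : ℂ)| ≤
        |Δ b j| + |Δ a b| := by
      rw [inner_sub_left, ← sub_add_sub_cancel _ (inner ℝ (x j : ℂ) (x b : ℂ))]
      refine (abs_add_le _ _).trans ?_
      rw [add_comm]
      refine add_le_add ?_ ?_
      · refine (abs_inner_sub_inner_le _ _ _ _).trans ?_
        rw [geoDist_orthAct, hsymm]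
      · refine (abs_inner_sub_inner_le _ _ _ _).trans ?_
        refine (abs_geoDist_sub_le_right _ _ _).trans ?_
        rw [geoDist_comm]; exact hQb
    have f1 := sq_le_sq.2 (e1.trans (le_of_eq (abs_abs _).symm))
    have f2 := sq_le_sq.2 (e2.trans (le_abs_self _))
    rw [sq_abs] at f1
    have f3 : (|Δ b j| + |Δ a b|) ^ 2 ≤ 2 * (Δ b j ^ 2 + Δ a b ^ 2) := by
      rw [← sq_abs (Δ b j), ← sq_abs (Δ a b)]; nlinarith [sq_nonneg (|Δ b j| - |Δ a b|)]
    linarith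
  have hsum : (∑ j, ‖(x j : ℂ) - orthAct Q (z j)‖ ^ 2) * s ≤
      2 * (R a + 2 * R b + 2 * k * Δ a b ^ 2) := by
    rw [Finset.sum_mul]
    refine (Finset.sum_le_sum fun j _ => hpt j).trans (le_of_eq ?_)
    rw [← Finset.mul_sum, Finset.sum_add_distrib, ← Finset.mul_sum, Finset.sum_add_distrib,
      Finset.sum_const, Finset.card_univ, hY, nsmul_eq_mul]
    simp only [R]; ring
  have hs0 : 0 < s := by
    have h0 : 0 ≤ 2 * (R a + 2 * R b + 2 * k * Δ a b ^ 2) := by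
      have := hR0 a
      have := hR0 b
      positivity
    have h1 := h0.trans_lt hb
    exact (pos_iff_pos_of_mul_pos h1).1 (by positivity)
  have hN : ∑ j, ‖(x j : ℂ) - orthAct Q (z j)‖ ^ 2 ≤ 22 * Ψ / k :=
    le_of_mul_le_mul_right (hsum.trans hb.le) hs0
  calc ∑ j, geoDist (x j) (orthAct Q (z j)) ^ 2
      ≤ ∑ j, Real.pi ^ 2 / 4 * ‖(x j : ℂ) - orthAct Q (z j)‖ ^ 2 :=
        Finset.sum_le_sum fun j _ => geoDist_sq_le _ _
    _ = Real.pi ^ 2 / 4 * ∑ j, ‖(x j : ℂ) - orthAct Q (z j)‖ ^ 2 := by rw [Finset.mul_sum]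
    _ ≤ 10 / 4 * (22 * Ψ / k) := by gcongr; exact pi_sq_le_ten
    _ ≤ 60 * Ψ / k := by
      rw [← mul_div_assoc]
      exact div_le_div_of_nonneg_right (by linarith) hk'.le

/-- The deterministic analysis of the refinement. -/
theorem refine_localization {n k : ℕ} [NeZero k] (hk : 3 ≤ k) {cl cL ε Λ ν : ℝ}
    {F : Matrix (Fin n) (Fin n) ℝ}
    {u : Fin n → Circle} (h : CircleBiLipschitz cl cL ε F u) (hcl : 0 < cl) (hcL : 0 ≤ cL)
    (hε : 0 ≤ ε) (hν : 0 ≤ ν) {T : Finset (Fin n)} (e : T ≃ Fin k) (Q : ℂ ≃ₗᵢ[ℝ] ℂ)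
    (hΛ : ∑ j : T, geoDist (gridPoint k (e j)) (orthAct Q (u j)) ≤ Λ) (i : Fin n) (p q : Fin k)
    (hp : geoDist (gridPoint k p) (orthAct Q (u i)) ≤ Real.pi / k) (W : T → ℝ)
    (hmin : ∑ j : T, (F i j + W j) * geoDist (gridPoint k q) (gridPoint k (e j)) ≤
      ∑ j : T, (F i j + W j) * geoDist (gridPoint k p) (gridPoint k (e j)))
    (hW : ∑ j, W j * (geoDist (gridPoint k p) (gridPoint k (e j)) -
        geoDist (gridPoint k q) (gridPoint k (e j))) ≤
      ν * geoDist (gridPoint k q) (gridPoint k p)) :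
    cl * k / 10 * geoDist (gridPoint k q) (gridPoint k p) ≤
      ν + cL * Λ + k * (cL * (Real.pi / n) + ε) +
        k * (2 * (cl + cL) * (Real.pi / k + Real.pi / n) + 2 * ε) := by
  have hpi := pi_pos
  have hk' : (0 : ℝ) < k := by exact_mod_cast (by omega : 0 < k)
  have hn' : (0 : ℝ) < n := by exact_mod_cast i.pos
  have hΛ0 : 0 ≤ Λ := (Finset.sum_nonneg fun j _ => geoDist_nonneg _ _).trans hΛ
  set η := 2 * (cl + cL) * (Real.pi / k + Real.pi / n) + 2 * ε with hη
  have hη0 : 0 ≤ η := by positivity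
  have hcard : Fintype.card T = k := by simpa using Fintype.card_congr e
  set ζ := geoDist (gridPoint k q) (gridPoint k p) with hζ
  have hζ0 : 0 ≤ ζ := geoDist_nonneg _ _
  -- The estimated position of `j` is nearly the image under `Q` of the latent position of `κ j`.
  -- Replacing `F i j` by `F i (κ j)` gives a row that decreases in the estimated distances; the
  -- replacement is paid for in `h3`, through the total displacement `Λ`.
  choose κ hκ using fun j : T => h.dense (orthAct Q.symm (gridPoint k (e j)))
  have hκ' : ∀ j, geoDist (gridPoint k (e j)) (orthAct Q (u (κ j))) ≤ Real.pi / n := fun j => by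
    have := hκ j
    rwa [← geoDist_orthAct Q, orthAct_symm_apply] at this
  let D : T → ℝ := fun j => geoDist (gridPoint k q) (gridPoint k (e j)) -
    geoDist (gridPoint k p) (gridPoint k (e j))
  have hD : ∀ j, |D j| ≤ ζ := fun j => abs_geoDist_sub_le _ _ _
  have h1 : cl / 2 * ∑ j, D j ^ 2 - η * ∑ j, |D j| ≤ ∑ j : T, F i (κ j) * D j := by
    refine rearrangement_quadratic (fun j : T => F i (κ j))
      (fun j => geoDist (gridPoint k p) (gridPoint k (e j)))
      (fun j => geoDist (gridPoint k q) (gridPoint k (e j)))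
      ((e.trans (Equiv.addRight (p - q))).trans e.symm) (fun j => ?_) (fun j j' hjj => ?_)
    · simpa using geoDist_gridPoint_shift p q (e j)
    · refine h.decrease hcl.le hcL hε hjj ?_ ?_
      · rw [← geoDist_orthAct Q (u i)]
        exact (abs_geoDist_sub_geoDist_le _ _ _ _).trans (add_le_add hp (hκ' j))
      · rw [← geoDist_orthAct Q (u i)]
        exact (abs_geoDist_sub_geoDist_le _ _ _ _).trans (add_le_add hp (hκ' j'))
  have h2 : ∑ j : T, F i j * D j ≤ ν * ζ := by
    refine le_trans ?_ hW
    rw [← sub_nonneg, ← Finset.sum_sub_distrib] at hmin ⊢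
    refine hmin.trans (le_of_eq (Finset.sum_congr rfl fun j _ => ?_))
    simp only [D]; ring
  have h3 : ∑ j : T, (F i (κ j) - F i j) * D j ≤ (cL * Λ + k * (cL * (Real.pi / n) + ε)) * ζ := by
    have : ∀ j : T, (F i (κ j) - F i j) * D j ≤
        (cL * geoDist (gridPoint k (e j)) (orthAct Q (u j)) + (cL * (Real.pi / n) + ε)) * ζ := by
      intro j
      refine (le_abs_self _).trans ?_
      rw [abs_mul]
      refine mul_le_mul ?_ (hD j) (abs_nonneg _) (by have := geoDist_nonneg (gridPoint k (e j)) (orthAct Q (u j)); positivity)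
      refine (h.upper i (κ j) j).trans ?_
      rw [← geoDist_orthAct Q (u (κ j))]
      have t := geoDist_triangle (orthAct Q (u (κ j))) (gridPoint k (e j)) (orthAct Q (u j))
      rw [geoDist_comm _ (gridPoint k (e j))] at t
      have t2 := mul_le_mul_of_nonneg_left (t.trans (add_le_add_left (hκ' j) _)) hcL
      linarith
    refine (Finset.sum_le_sum fun j _ => this j).trans ?_
    rw [← Finset.sum_mul, Finset.sum_add_distrib, ← Finset.mul_sum, Finset.sum_const,
      Finset.card_univ, hcard, nsmul_eq_mul]
    gcongr
  have h4 : ∑ j, |D j| ≤ k * ζ := by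
    refine (Finset.sum_le_sum fun j _ => hD j).trans (le_of_eq ?_)
    rw [Finset.sum_const, Finset.card_univ, hcard, nsmul_eq_mul]
  -- Differences of distances dominate differences of cosines, and the tight frame identity
  -- evaluates the squares of the latter.
  have h5 : 2 * k / 10 * ζ ^ 2 ≤ ∑ j, D j ^ 2 := by
    have e1 : ∑ j, D j ^ 2 = ∑ c : Fin k, (geoDist (gridPoint k q) (gridPoint k c) -
      geoDist (gridPoint k p) (gridPoint k c)) ^ 2 :=
      Equiv.sum_comp e fun c => (geoDist (gridPoint k q) (gridPoint k c) -
        geoDist (gridPoint k p) (gridPoint k c)) ^ 2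
    have e2 := sum_inner_gridPoint_sq hk ((gridPoint k q : ℂ) - gridPoint k p) 1
    simp only [one_mul] at e2
    have e3 := geoDist_sq_le (gridPoint k q) (gridPoint k p)
    rw [← hζ] at e3
    have e4 : ζ ^ 2 ≤ 10 / 4 * ‖(gridPoint k q : ℂ) - gridPoint k p‖ ^ 2 := by
      refine e3.trans ?_
      gcongr; exact pi_sq_le_ten
    calc 2 * k / 10 * ζ ^ 2 ≤ 2 * k / 10 * (10 / 4 * ‖(gridPoint k q : ℂ) - gridPoint k p‖ ^ 2) := by
          gcongr
      _ = k / 2 * ‖(gridPoint k q : ℂ) - gridPoint k p‖ ^ 2 := by ring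
      _ ≤ _ := by
        rw [← e2, e1]
        refine Finset.sum_le_sum fun c _ => sq_le_sq.2 ?_
        rw [inner_sub_left]
        exact abs_inner_sub_inner_le _ _ _ _
  have h6 : cl * k / 10 * ζ * ζ ≤
      (ν + cL * Λ + k * (cL * (Real.pi / n) + ε) + k * η) * ζ := by
    have e1 : ∑ j : T, F i (κ j) * D j = ∑ j : T, F i j * D j + ∑ j : T, (F i (κ j) - F i j) * D j := by
      rw [← Finset.sum_add_distrib]; exact Finset.sum_congr rfl fun j _ => by ring
    have e2 := mul_le_mul_of_nonneg_left h5 (by positivity : 0 ≤ cl / 2)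
    have e3 := mul_le_mul_of_nonneg_left h4 hη0
    rw [e1] at h1
    linarith
  rcases eq_or_lt_of_le hζ0 with h0 | h0
  · rw [← h0, mul_zero]; positivity
  · exact le_of_mul_le_mul_right h6 h0

/-! ### Merging the two localizations. -/

/-- Two orthogonal transformations that agree approximately on two points in general position
agree approximately everywhere. -/
theorem geoDist_orthAct_orthAct_le (Q R : ℂ ≃ₗᵢ[ℝ] ℂ) (a b v : Circle) {κ : ℝ} (hκ : 0 ≤ κ)
    (hab : 1 / 8 ≤ 1 - (inner ℝ (a : ℂ) (b : ℂ)) ^ 2)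
    (ha : geoDist (orthAct Q a) (orthAct R a) ≤ κ) (hb : geoDist (orthAct Q b) (orthAct R b) ≤ κ) :
    geoDist (orthAct Q v) (orthAct R v) ≤ 9 * κ := by
  -- Since `⟪Qv, Qc⟫ = ⟪Rv, Rc⟫`, pairing `Qv - Rv` with `Qc` only sees the distance from `Qc` to
  -- `Rc`.
  have key : ∀ c : Circle, geoDist (orthAct Q c) (orthAct R c) ≤ κ →
      (inner ℝ ((orthAct Q v : ℂ) - orthAct R v) (orthAct Q c : ℂ)) ^ 2 ≤ κ ^ 2 := fun c hc => by
    refine sq_le_sq.2 (le_trans ?_ (hc.trans (le_abs_self _)))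
    rw [inner_sub_left]
    refine (abs_inner_sub_inner_le _ _ _ _).trans ?_
    rw [geoDist_orthAct, ← geoDist_orthAct R, abs_sub_comm]
    exact abs_geoDist_sub_le_right _ _ _
  have h := norm_sq_mul_sin_sq_le ((orthAct Q v : ℂ) - orthAct R v) (orthAct Q a) (orthAct Q b)
  rw [← cos_geoDist, geoDist_orthAct, cos_geoDist] at h
  have h1 := key a ha
  have h2 := key b hb
  have h3 := mul_le_mul_of_nonneg_left hab (sq_nonneg ‖(orthAct Q v : ℂ) - orthAct R v‖)
  have h4 : ‖(orthAct Q v : ℂ) - orthAct R v‖ ^ 2 ≤ 32 * κ ^ 2 := by linarith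
  refine (abs_le_of_sq_le_sq' ?_ (by positivity)).2
  -- The bound `9` comes from `10 / 4 * 32 = 80 ≤ 9 ^ 2`.
  calc _ ≤ Real.pi ^ 2 / 4 * ‖(orthAct Q v : ℂ) - orthAct R v‖ ^ 2 := geoDist_sq_le _ _
    _ ≤ 10 / 4 * (32 * κ ^ 2) := by gcongr; exact pi_sq_le_ten
    _ ≤ (9 * κ) ^ 2 := by nlinarith [sq_nonneg κ]

/-- The deterministic analysis of the merging step. -/
theorem merge_localization {n : ℕ} {u : Fin n → Circle} {S S' : Finset (Fin n)}
    (hdisj : Disjoint S S') (hcard : 2 * (S.card + S'.card) ≤ n) (hn : 0 < n)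
    (hu : ∀ i, ∑ j, (inner ℝ (u i : ℂ) (u j : ℂ)) ^ 4 = 3 * (n : ℝ) / 8)
    {y y' x : Fin n → Circle} {Q Q₁ Q₂ : ℂ ≃ₗᵢ[ℝ] ℂ} {κ : ℝ} (hκ : 0 ≤ κ)
    (hy : ∀ i ∉ S, geoDist (y i) (orthAct Q₁ (u i)) ≤ κ)
    (hy' : ∀ i ∉ S', geoDist (y' i) (orthAct Q₂ (u i)) ≤ κ)
    (hQ : IsMinOn (mergeCriterion S S' y y') Set.univ Q)
    (hx : ∀ i ∉ S, x i = y i) (hx' : ∀ i ∈ S, x i = orthAct Q (y' i)) (i : Fin n) :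
    geoDist (x i) (orthAct Q₁ (u i)) ≤ 37 * κ := by
  let M : Finset (Fin n) := (S ∪ S')ᶜ
  have hM : ∀ i, i ∈ M ↔ i ∉ S ∧ i ∉ S' := fun i => by simp [M]
  have hMcard : (n : ℝ) / 2 ≤ M.card := by
    have h1 : M.card = n - (S.card + S'.card) := by
      rw [Finset.card_compl, Finset.card_union_of_disjoint hdisj, Fintype.card_fin]
    have h2 : n ≤ 2 * M.card := by omega
    have : (n : ℝ) ≤ 2 * M.card := by exact_mod_cast h2
    linarith
  have hn' : (0 : ℝ) < n := by exact_mod_cast hn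
  obtain ⟨a, haM⟩ : M.Nonempty := by
    rw [← Finset.card_pos]
    have : (0 : ℝ) < M.card := by linarith
    exact_mod_cast this
  -- With `t` the squared inner product, `1 - t ≥ (1 - t ^ 2) / 2`, so the sum over `M` is at least
  -- `|M| / 2 - 3 * n / 16 ≥ |M| / 8`. Second moments would not do: their total is `n / 2`, which
  -- `|M|` may equal.
  obtain ⟨b, hbM, hab⟩ : ∃ b ∈ M, 1 / 8 ≤ 1 - (inner ℝ (u a : ℂ) (u b : ℂ)) ^ 2 := by
    refine Finset.exists_le_of_sum_le ⟨a, haM⟩ ?_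
    have h1 : ∑ j ∈ M, (inner ℝ (u a : ℂ) (u j : ℂ)) ^ 4 ≤ 3 * (n : ℝ) / 8 := by
      rw [← hu a]
      exact Finset.sum_le_sum_of_subset_of_nonneg (Finset.subset_univ _) fun _ _ _ => by positivity
    have h2 : ∀ j ∈ M, 1 / 2 - (inner ℝ (u a : ℂ) (u j : ℂ)) ^ 4 / 2 ≤
        1 - (inner ℝ (u a : ℂ) (u j : ℂ)) ^ 2 := fun j _ => by
      nlinarith [sq_nonneg (1 - (inner ℝ (u a : ℂ) (u j : ℂ)) ^ 2)]
    refine le_trans ?_ (Finset.sum_le_sum h2)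
    rw [Finset.sum_const, Finset.sum_sub_distrib, Finset.sum_const, ← Finset.sum_div, nsmul_eq_mul,
      nsmul_eq_mul]
    linarith
  have : Nonempty {i : Fin n // i ∉ S ∧ i ∉ S'} := ⟨⟨a, (hM a).1 haM⟩⟩
  -- The competitor is `Q₁ ∘ Q₂⁻¹`, which aligns the two latent frames exactly.
  have hval : mergeCriterion S S' y y' Q ≤ 2 * κ := by
    refine (isMinOn_iff.1 hQ (Q₂.symm.trans Q₁) (Set.mem_univ _)).trans ?_
    refine ciSup_le fun j => ?_
    have h1 := geoDist_triangle (y j) (orthAct Q₁ (u j)) (orthAct (Q₂.symm.trans Q₁) (y' j))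
    have h2 := hy j j.2.1
    have h3 := hy' j j.2.2
    rw [orthAct_trans, geoDist_orthAct, ← geoDist_orthAct Q₂ (u j), orthAct_symm_apply,
      geoDist_comm _ (y' j)] at h1
    rw [orthAct_trans]
    linarith
  have hclose : ∀ j ∈ M, geoDist (orthAct (Q₂.trans Q) (u j)) (orthAct Q₁ (u j)) ≤ 4 * κ := by
    intro j hj
    have hj' := (hM j).1 hj
    have h1 : geoDist (y j) (orthAct Q (y' j)) ≤ mergeCriterion S S' y y' Q :=
      le_ciSup (f := fun i : {i : Fin n // i ∉ S ∧ i ∉ S'} => geoDist (y i) (orthAct Q (y' i)))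
        (Set.finite_range _).bddAbove ⟨j, hj'⟩
    have h2 := hy j hj'.1
    have h3 := hy' j hj'.2
    rw [← geoDist_orthAct Q, geoDist_comm] at h3
    rw [orthAct_trans]
    have t1 := geoDist_triangle (orthAct Q (orthAct Q₂ (u j))) (orthAct Q (y' j)) (orthAct Q₁ (u j))
    have t2 := geoDist_triangle (orthAct Q (y' j)) (y j) (orthAct Q₁ (u j))
    rw [geoDist_comm _ (y j)] at t2
    linarith
  by_cases hi : i ∈ S
  · have hi' : i ∉ S' := Finset.disjoint_left.1 hdisj hi
    -- The discrepancy `4 * κ` on the anchors extends to `9 * (4 * κ)` everywhere; the error of `y'`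
    -- adds one more `κ`.
    have h1 := geoDist_orthAct_orthAct_le (Q₂.trans Q) Q₁ (u a) (u b) (u i) (by positivity) hab
      (hclose a haM) (hclose b hbM)
    have h2 := hy' i hi'
    rw [← geoDist_orthAct Q] at h2
    rw [hx' i hi]
    rw [orthAct_trans] at h1
    linarith [geoDist_triangle (orthAct Q (y' i)) (orthAct Q (orthAct Q₂ (u i))) (orthAct Q₁ (u i))]
  · rw [hx i hi]
    linarith [hy i hi]

/-! ### From orthogonal maps to the symmetry group of the torus. -/

theorem exists_symmetryGroup_shift (n : ℕ) (m : ℕ) : ∃ τ ∈ symmetryGroup n, ∀ i,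
    torusPoint n (label (τ i)) = torusPoint n m * torusPoint n (label i) := by
  have hrot : ∀ i : Fin n,
      torusPoint n (label (finRotate n i)) = torusPoint n 1 * torusPoint n (label i) := by
    intro i
    obtain ⟨k, rfl⟩ : ∃ k, n = k + 1 := ⟨n - 1, by have := i.pos; omega⟩
    rw [finRotate_apply, ← torusPoint_add]
    refine torusPoint_eq_of_modEq ?_
    rw [label, label, Fin.val_add, Fin.val_one']
    push_cast
    rw [add_comm 1]
    refine Int.ModEq.add_right _ ((Int.mod_modEq _ _).trans ?_)
    exact Int.ModEq.add_left _ (Int.mod_modEq _ _)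
  induction m with
  | zero => exact ⟨1, one_mem _, fun i => by simp [torusPoint]⟩
  | succ m ih =>
    obtain ⟨τ, hτ, h⟩ := ih
    refine ⟨finRotate n * τ, mul_mem (Subgroup.subset_closure (by simp)) hτ, fun i => ?_⟩
    rw [Equiv.Perm.mul_apply, hrot, h, ← mul_assoc, ← torusPoint_add]
    congr 2; push_cast; ring

theorem torusPoint_label_rev {n : ℕ} (i : Fin n) :
    torusPoint n (label (Fin.revPerm i)) = torusPoint n 1 * (torusPoint n (label i))⁻¹ := by
  rw [← torusPoint_neg, ← torusPoint_add]
  refine torusPoint_eq_of_modEq ?_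
  rw [label, label, Fin.revPerm_apply, Fin.val_rev, Nat.cast_sub (by omega)]
  refine (Int.modEq_iff_dvd.2 ⟨-1, ?_⟩)
  push_cast; ring

/-- An orthogonal transformation is approximated by an element of the symmetry group. -/
theorem exists_symmetryGroup_near {n : ℕ} (hn : 0 < n) (Q : ℂ ≃ₗᵢ[ℝ] ℂ) :
    ∃ τ ∈ symmetryGroup n, ∀ i, geoDist (torusPoint n (label (τ i)))
      (orthAct Q (torusPoint n (label i))) ≤ Real.pi / n := by
  have near : ∀ c : Circle, ∃ τ ∈ symmetryGroup n, ∀ i,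
      geoDist (torusPoint n (label (τ i))) (c * torusPoint n (label i)) ≤ Real.pi / n := fun c => by
    obtain ⟨m, hm⟩ := exists_gridPoint_near hn c
    obtain ⟨τ, hτ, h⟩ := exists_symmetryGroup_shift n m
    refine ⟨τ, hτ, fun i => ?_⟩
    rwa [h, mul_comm, mul_comm c, geoDist_mul_left, geoDist_comm, ← gridPoint_eq_torusPoint]
  obtain ⟨c, rfl | rfl⟩ := linear_isometry_complex Q
  · obtain ⟨τ, hτ, h⟩ := near c
    exact ⟨τ, hτ, fun i => by rw [orthAct_rotation]; exact h i⟩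
  -- Reversal sends a label `a` to `n + 1 - a`, which is conjugation followed by one step of
  -- rotation; the inverse factor removes that step.
  · obtain ⟨τ, hτ, h⟩ := near (c * (torusPoint n 1)⁻¹)
    refine ⟨τ * Fin.revPerm, mul_mem hτ (Subgroup.subset_closure (by simp)), fun i => ?_⟩
    have := h (Fin.revPerm i)
    rw [orthAct_trans, orthAct_conj, orthAct_rotation]
    rwa [Equiv.Perm.mul_apply, torusPoint_label_rev, ← mul_assoc, inv_mul_cancel_right] at *

/-- From positions on the circle to positions on the torus. -/
theorem exists_symmetryGroup_torusDist_le {n : ℕ} (hn : 0 < n) (σ : Equiv.Perm (Fin n))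
    (x : Fin n → Circle) (Q : ℂ ≃ₗᵢ[ℝ] ℂ) {ρ : ℝ}
    (h : ∀ i, geoDist (x i) (orthAct Q (torusPoint n (label (σ i)))) ≤ ρ) :
    ∃ τ ∈ symmetryGroup n, ∀ i, 2 * Real.pi / n *
      (torusDist n (label (τ (σ i))) (sigmaHat x i) : ℝ) ≤ ρ + 3 * Real.pi / n := by
  obtain ⟨τ, hτ, hτ'⟩ := exists_symmetryGroup_near hn Q
  refine ⟨τ, hτ, fun i => ?_⟩
  have h1 := hτ' (σ i)
  have h2 := h i
  have h3 := geoDist_torusPoint_sigmaHat x i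
  rw [← geoDist_torusPoint hn]
  · have t1 := geoDist_triangle (torusPoint n (label (τ (σ i)))) (x i) (torusPoint n (sigmaHat x i))
    have t2 := geoDist_triangle (torusPoint n (label (τ (σ i))))
      (orthAct Q (torusPoint n (label (σ i)))) (x i)
    rw [geoDist_comm (orthAct Q _) (x i)] at t2
    have e : 3 * Real.pi / n = Real.pi / n + 2 * Real.pi / n := by ring
    linarith
  · have h4 := sigmaHat_mem x i
    have h5 := (τ (σ i)).2
    rw [label, abs_le]
    constructor <;> have := h4.1 <;> have := h4.2 <;> omega

/-! ### Sampling without replacement spreads the subsets over the torus. -/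

/-- The positions of the points of `T` are spread on the torus, up to `s`. -/
def IsSpread {n : ℕ} (σ : Equiv.Perm (Fin n)) (s : ℝ) (T : Finset (Fin n)) : Prop :=
  ∀ m ≤ n, |((T.filter fun j => (σ j : ℕ) < m).card : ℝ) - m / 4| ≤ s

/-- Match the points of `T` to the grid by rank. The rank of `j` counts the points of `T` strictly
before it, hence is `σ j / 4` up to `s`. The extra `1 / 4` arises because labels start at 1 and grid
indices at 0. -/
theorem IsSpread.exists_regular {n k : ℕ} {σ : Equiv.Perm (Fin n)} {s : ℝ} {T : Finset (Fin n)}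
    (h : IsSpread σ s T) (hT : T.card = k) (hk : 0 < k) (hn : n = 4 * k) :
    ∃ e : T ≃ Fin k, ∀ j, geoDist (gridPoint k (e j)) (torusPoint n (label (σ j))) ≤
      2 * Real.pi / k * (s + 1 / 4) := by
  have hpi := pi_pos
  have hk' : (0 : ℝ) < k := by exact_mod_cast hk
  let r : T → Finset (Fin n) := fun j => T.filter fun i => (σ i : ℕ) < σ j
  have hr : ∀ j, (r j).card < k := fun j => by
    rw [← hT]
    refine Finset.card_lt_card (Finset.filter_ssubset.2 ⟨j, j.2, lt_irrefl _⟩)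
  have hmono : ∀ i j : T, (σ i : ℕ) < σ j → (r i).card < (r j).card := fun i j hij => by
    refine Finset.card_lt_card ⟨fun x hx => ?_, fun hsub => ?_⟩
    · simp only [r, Finset.mem_filter] at hx ⊢
      exact ⟨hx.1, hx.2.trans hij⟩
    · have : (i : Fin n) ∈ r j := by simp only [r, Finset.mem_filter]; exact ⟨i.2, hij⟩
      have := hsub this
      simp [r] at this
  have hinj : Function.Injective fun j => (⟨(r j).card, hr j⟩ : Fin k) := fun i j hij => by
    have hij' : (r i).card = (r j).card := congrArg Fin.val hij
    rcases lt_trichotomy (σ i : ℕ) (σ j) with h1 | h1 | h1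
    · exact absurd hij' (hmono i j h1).ne
    · exact Subtype.ext (σ.injective (Fin.ext h1))
    · exact absurd hij' (hmono j i h1).ne'
  have hbij := (Fintype.bijective_iff_injective_and_card _).2 ⟨hinj, by simp [hT]⟩
  refine ⟨Equiv.ofBijective _ hbij, fun j => ?_⟩
  rw [gridPoint]
  refine (geoDist_exp_le _ _).trans ?_
  have hs := h (σ j) (σ j).2.le
  have e : 2 * Real.pi * (((r j).card : ℕ) : ℝ) / k - 2 * Real.pi * ((label (σ j) : ℤ) : ℝ) / n =
      2 * Real.pi / k * (((r j).card : ℝ) - ((σ j : ℕ) : ℝ) / 4 - 1 / 4) := by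
    have hn' : (n : ℝ) = 4 * k := by exact_mod_cast hn
    rw [label, hn']; push_cast; field_simp; ring
  simp only [Equiv.ofBijective_apply]
  rw [e, abs_mul, abs_of_pos (by positivity)]
  gcongr
  refine (abs_sub _ _).trans ?_
  rw [abs_of_pos (by norm_num : (0 : ℝ) < 1 / 4)]
  gcongr

/-- Up to normalization these are the binomial weights of parameters `4k` and `1/4`, with mode at
`k`: consecutive weights have ratio `(4k - j) / (3(j + 1))`, at least 1 before `k` and at most 1
from `k` on. -/
theorem choose_mul_three_pow_le {k j : ℕ} (hj : j ≤ 4 * k) :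
    (4 * k).choose j * 3 ^ (4 * k - j) ≤ (4 * k).choose k * 3 ^ (3 * k) := by
  set f : ℕ → ℕ := fun j => (4 * k).choose j * 3 ^ (4 * k - j) with hf
  have hstep : ∀ j < 4 * k, f (j + 1) * (3 * (j + 1)) = f j * (4 * k - j) := fun j hj => by
    simp only [hf]
    have h1 := Nat.choose_succ_right_eq (4 * k) j
    have h2 : 4 * k - j = (4 * k - (j + 1)) + 1 := by omega
    have h3 : 3 ^ (4 * k - j) = 3 ^ (4 * k - (j + 1)) * 3 := by rw [h2, pow_succ]
    rw [h3]
    calc _ = ((4 * k).choose (j + 1) * (j + 1)) * (3 ^ (4 * k - (j + 1)) * 3) := by ring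
      _ = _ := by rw [h1]; ring
  have h1 : ∀ d ≤ k, f (k - d) ≤ f k := by
    intro d
    induction d with
    | zero => intro _; exact le_rfl
    | succ d ih =>
      intro hd
      refine le_trans ?_ (ih (by omega))
      have h := hstep (k - (d + 1)) (by omega)
      rw [show k - (d + 1) + 1 = k - d by omega] at h
      refine Nat.le_of_mul_le_mul_right (c := 3 * (k - d)) ?_ (by omega)
      rw [h]
      exact Nat.mul_le_mul_left _ (by omega)
  have h2 : ∀ d, k + d ≤ 4 * k → f (k + d) ≤ f k := by
    intro d
    induction d with
    | zero => intro _; exact le_rfl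
    | succ d ih =>
      intro hd
      refine le_trans ?_ (ih (by omega))
      have h := hstep (k + d) (by omega)
      refine Nat.le_of_mul_le_mul_right (c := 3 * (k + d + 1)) ?_ (by omega)
      rw [← add_assoc, h]
      exact Nat.mul_le_mul_left _ (by omega)
  have e : (4 * k).choose k * 3 ^ (3 * k) = f k := by
    simp only [hf]; congr 2; omega
  rw [e]
  change f j ≤ f k
  rcases le_total j k with h | h
  · have := h1 (k - j) (by omega)
    rwa [show k - (k - j) = j by omega] at this
  · have := h2 (j - k) (by omega)
    rwa [show k + (j - k) = j by omega] at this

/-- The mode of a law on `4k + 1` values has mass at least `1 / (4k + 1)`. This is the price for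
conditioning independent sampling at rate `1/4` on the cardinality `k`. -/
theorem four_pow_le_choose (k : ℕ) :
    4 ^ (4 * k) ≤ (4 * k + 1) * ((4 * k).choose k * 3 ^ (3 * k)) := by
  have h := add_pow 1 3 (4 * k)
  simp only [one_pow, one_mul] at h
  rw [show (4 : ℕ) = 1 + 3 from rfl]
  rw [show (1 + 3 : ℕ) * k = 4 * k from rfl, h]
  refine (Finset.sum_le_card_nsmul _ _ ((4 * k).choose k * 3 ^ (3 * k)) fun j hj => ?_).trans ?_
  · rw [mul_comm]
    exact choose_mul_three_pow_le (by simpa [Nat.lt_succ_iff] using hj)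
  · simp

/-- A Chernoff bound for sampling without replacement. -/
theorem card_powersetCard_filter_le {n k : ℕ} (hn : n = 4 * k) (I : Finset (Fin n)) {l t : ℝ}
    (hl : |l| ≤ 1) :
    (((Finset.powersetCard k (Finset.univ : Finset (Fin n))).filter
      fun T => t ≤ l * (((T ∩ I).card : ℝ) - (I.card : ℝ) / 4)).card : ℝ) ≤
      (n + 1) * n.choose k * Real.exp (l ^ 2 * k - t) := by
  subst hn
  push_cast
  set P := Finset.powersetCard k (Finset.univ : Finset (Fin (4 * k))) with hP
  -- The sets of size `k` are some of the terms in the expansion of a product over points, as for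
  -- independent sampling. Each factor is bounded with `exp l ≤ 1 + l + l²` for `|l| ≤ 1`.
  have hprod : ∑ T ∈ P, Real.exp (l * (T ∩ I).card) * 3 ^ (3 * k) ≤
      4 ^ (4 * k) * Real.exp ((l / 4 + l ^ 2 / 4) * I.card) := by
    have h1 := Finset.prod_add (fun j : Fin (4 * k) => if j ∈ I then Real.exp l else 1)
      (fun _ => (3 : ℝ)) Finset.univ
    have h2 : ∑ T ∈ P, Real.exp (l * (T ∩ I).card) * 3 ^ (3 * k) ≤
        ∏ j : Fin (4 * k), ((if j ∈ I then Real.exp l else 1) + 3) := by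
      rw [h1]
      refine le_trans (le_of_eq (Finset.sum_congr rfl fun T hT => ?_))
        (Finset.sum_le_sum_of_subset_of_nonneg (f := fun T => (∏ j ∈ T, if j ∈ I then Real.exp l else 1) *
          ∏ j ∈ Finset.univ \ T, (3 : ℝ)) (s := P) ?_ fun T _ _ => ?_)
      · have hT' := (Finset.mem_powersetCard.1 hT).2
        rw [Finset.prod_ite_mem, Finset.prod_const, Finset.prod_const,
          ← Finset.compl_eq_univ_sdiff, Finset.card_compl, hT', Fintype.card_fin, ← Real.exp_nat_mul,
          mul_comm l]
        congr 2; omega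
      · intro T hT; simp
      · refine mul_nonneg (Finset.prod_nonneg fun j _ => ?_) (Finset.prod_nonneg fun _ _ => by norm_num)
        split_ifs <;> positivity
    refine h2.trans ?_
    have h3 : ∀ j : Fin (4 * k), (if j ∈ I then Real.exp l else 1) + 3 ≤
        4 * (if j ∈ I then Real.exp (l / 4 + l ^ 2 / 4) else 1) := fun j => by
      split_ifs
      · have e1 := (abs_le.1 (Real.abs_exp_sub_one_sub_id_le hl)).2
        have e2 := Real.add_one_le_exp (l / 4 + l ^ 2 / 4)
        linarith
      · norm_num
    refine (Finset.prod_le_prod (fun j _ => ?_) fun j _ => h3 j).trans (le_of_eq ?_)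
    · split_ifs <;> positivity
    · rw [Finset.prod_mul_distrib, Finset.prod_const, Finset.card_univ, Fintype.card_fin,
        Finset.prod_ite_mem, Finset.univ_inter, Finset.prod_const, ← Real.exp_nat_mul,
        mul_comm (I.card : ℝ)]
  have hI : (I.card : ℝ) ≤ 4 * k := by
    have := Finset.card_le_univ I
    rw [Fintype.card_fin] at this
    exact_mod_cast this
  set B := P.filter fun T => t ≤ l * (((T ∩ I).card : ℝ) - (I.card : ℝ) / 4)
  have hB : (B.card : ℝ) * (Real.exp (l * I.card / 4 + t) * 3 ^ (3 * k)) ≤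
      ∑ T ∈ P, Real.exp (l * (T ∩ I).card) * 3 ^ (3 * k) := by
    rw [← nsmul_eq_mul]
    refine (Finset.card_nsmul_le_sum B _ _ fun T hT => ?_).trans
      (Finset.sum_le_sum_of_subset_of_nonneg (Finset.filter_subset _ _) fun _ _ _ => by positivity)
    have := (Finset.mem_filter.1 hT).2
    gcongr
    linarith
  have h4 : (4 : ℝ) ^ (4 * k) ≤ (4 * k + 1) * ((4 * k).choose k * 3 ^ (3 * k)) := by
    exact_mod_cast four_pow_le_choose k
  have hpos : 0 < Real.exp (l * I.card / 4 + t) * 3 ^ (3 * k) := by positivity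
  refine le_of_mul_le_mul_right ((hB.trans hprod).trans ?_) hpos
  calc (4 : ℝ) ^ (4 * k) * Real.exp ((l / 4 + l ^ 2 / 4) * I.card)
      ≤ ((4 * k + 1) * ((4 * k).choose k * 3 ^ (3 * k))) *
          Real.exp (l ^ 2 * k - t + (l * I.card / 4 + t)) := by
        gcongr
        nlinarith [sq_nonneg l, mul_le_mul_of_nonneg_left hI (sq_nonneg l)]
    _ = _ := by rw [Real.exp_add]; ring

theorem card_filter_val_lt {n m : ℕ} (σ : Equiv.Perm (Fin n)) (hm : m ≤ n) :
    (Finset.univ.filter fun j => (σ j : ℕ) < m).card = m := by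
  have h1 : (Finset.univ.filter fun j => (σ j : ℕ) < m).card =
      (Finset.univ.filter fun j : Fin n => (j : ℕ) < m).card := by
    refine Finset.card_bij (fun j _ => σ j) (by simp) (fun _ _ _ _ h => σ.injective h)
      fun j hj => ⟨σ.symm j, by simpa using hj, by simp⟩
  rw [h1, Fin.card_filter_val_lt]
  exact min_eq_right hm

/-- Most subsets with `n / 4` elements are spread. -/
theorem card_not_isSpread_le {n k : ℕ} (hk : 0 < k) (hn : n = 4 * k) (σ : Equiv.Perm (Fin n))
    {s : ℝ} (hs : s = √(n * Real.log n)) [DecidablePred (IsSpread σ (8 * s))] :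
    (((Finset.powersetCard k (Finset.univ : Finset (Fin n))).filter
      fun T => ¬ IsSpread σ (8 * s) T).card : ℝ) ≤
      n.choose k / (n : ℝ) ^ 2 := by
  have hn4 : (4 : ℝ) ≤ n := by rw [hn]; exact_mod_cast (by omega)
  have hkn : (k : ℝ) = n / 4 := by rw [hn]; push_cast; ring
  have hlog : 0 ≤ Real.log n := Real.log_nonneg (by linarith)
  -- With this tilt `l * s = log n`, so a deviation `8 * s` costs `8 * log n`, while `l² k = log n /
  -- 4`. The resulting `n⁻⁷` absorbs the factor `n + 1`, the `n + 1` thresholds and the two signs.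
  set l := s / n with hl
  have hs2 : s ^ 2 = n * Real.log n := by rw [hs]; exact Real.sq_sqrt (by positivity)
  have hl2 : l ^ 2 = Real.log n / n := by rw [hl, div_pow, hs2]; field_simp
  have hls : l * s = Real.log n := by rw [hl, div_mul_eq_mul_div, ← pow_two, hs2]; field_simp
  have hl0 : 0 ≤ l := by rw [hl, hs]; positivity
  have hl1 : |l| ≤ 1 := by
    rw [abs_of_nonneg hl0]
    refine (abs_le_of_sq_le_sq' ?_ zero_le_one).2
    rw [hl2, one_pow, div_le_one (by linarith)]
    have := Real.log_le_sub_one_of_pos (by linarith : (0 : ℝ) < n)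
    linarith
  let P := Finset.powersetCard k (Finset.univ : Finset (Fin n))
  let I : ℕ → Finset (Fin n) := fun m => Finset.univ.filter fun j => (σ j : ℕ) < m
  let B : ℝ → ℕ → Finset (Finset (Fin n)) := fun l m =>
    P.filter fun T => 8 * Real.log n ≤ l * (((T ∩ I m).card : ℝ) - ((I m).card : ℝ) / 4)
  have hBcard : ∀ l', |l'| = l → ∀ m, ((B l' m).card : ℝ) ≤ (n + 1) * n.choose k / n ^ 7 := by
    intro l' hl' m
    have h1 := card_powersetCard_filter_le hn (t := 8 * Real.log n) (I m) (l := l') (by rwa [hl', ← abs_of_nonneg hl0])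
    refine h1.trans ?_
    have e1 : l' ^ 2 = Real.log n / n := by rw [← sq_abs, hl', hl2]
    have e2 : Real.exp (l' ^ 2 * k - 8 * Real.log n) ≤ 1 / n ^ 7 := by
      rw [e1, hkn]
      have e3 : Real.log n / n * (n / 4) - 8 * Real.log n ≤ -(7 : ℕ) * Real.log n := by
        have : Real.log n / n * (n / 4) = Real.log n / 4 := by field_simp
        rw [this]; push_cast; linarith
      refine (Real.exp_le_exp.2 e3).trans (le_of_eq ?_)
      rw [neg_mul, Real.exp_neg, Real.exp_nat_mul, Real.exp_log (by linarith), one_div]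
    calc _ ≤ (n + 1) * (n.choose k : ℝ) * (1 / n ^ 7) := by gcongr
      _ = _ := by ring
  have hsub : P.filter (fun T => ¬ IsSpread σ (8 * s) T) ⊆
      (Finset.range (n + 1)).biUnion fun m => B l m ∪ B (-l) m := by
    intro T hT
    rw [Finset.mem_filter] at hT
    obtain ⟨hTP, hT⟩ := hT
    rw [IsSpread] at hT
    push Not at hT
    obtain ⟨m, hm, hT⟩ := hT
    rw [Finset.mem_biUnion]
    refine ⟨m, by rw [Finset.mem_range]; omega, ?_⟩
    have hIm : (I m).card = m := card_filter_val_lt σ hm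
    have hTI : T.filter (fun j => (σ j : ℕ) < m) = T ∩ I m := by ext; simp [I]
    rw [hTI] at hT
    rw [Finset.mem_union, Finset.mem_filter, Finset.mem_filter, hIm]
    rcases lt_abs.1 hT with h | h
    · left
      refine ⟨hTP, ?_⟩
      rw [← hls]
      have := mul_le_mul_of_nonneg_left h.le hl0
      linarith
    · right
      refine ⟨hTP, ?_⟩
      rw [← hls]
      have := mul_le_mul_of_nonneg_left h.le hl0
      linarith
  have hcount : ((P.filter (fun T => ¬ IsSpread σ (8 * s) T)).card : ℝ) ≤
      (n + 1) * (2 * ((n + 1) * n.choose k / n ^ 7)) := by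
    have h1 : (P.filter (fun T => ¬ IsSpread σ (8 * s) T)).card ≤
        ∑ m ∈ Finset.range (n + 1), ((B l m).card + (B (-l) m).card) :=
      (Finset.card_le_card hsub).trans (Finset.card_biUnion_le.trans
        (Finset.sum_le_sum fun m _ => Finset.card_union_le _ _))
    have h2 : ((P.filter (fun T => ¬ IsSpread σ (8 * s) T)).card : ℝ) ≤
        ∑ m ∈ Finset.range (n + 1), (((B l m).card : ℝ) + (B (-l) m).card) := by exact_mod_cast h1
    refine h2.trans ((Finset.sum_le_card_nsmul _ _ (2 * (((n : ℝ) + 1) * n.choose k / (n : ℝ) ^ 7))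
      fun m _ => ?_).trans (le_of_eq ?_))
    · have := hBcard l (abs_of_nonneg hl0) m
      have := hBcard (-l) (by rw [abs_neg, abs_of_nonneg hl0]) m
      linarith
    · rw [Finset.card_range, nsmul_eq_mul]; push_cast; ring
  refine hcount.trans ?_
  have hc : (0 : ℝ) ≤ n.choose k := by positivity
  have h8 : 2 * ((n : ℝ) + 1) ^ 2 ≤ n ^ 5 := by
    have e1 : ((n : ℝ) + 1) ^ 2 ≤ (2 * n) ^ 2 := by gcongr; linarith
    have e2 : (4 : ℝ) ^ 3 ≤ n ^ 3 := by gcongr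
    have e3 : (n : ℝ) ^ 5 = n ^ 3 * n ^ 2 := by ring
    rw [e3]
    nlinarith [sq_nonneg (n : ℝ)]
  rw [div_eq_mul_inv, le_div_iff₀ (by positivity)]
  calc _ = n.choose k * ((2 * ((n : ℝ) + 1) ^ 2) / n ^ 5) := by field_simp
    _ ≤ n.choose k * 1 := by
      gcongr
      rw [div_le_one (by positivity)]; exact h8
    _ = _ := mul_one _

/-! ### The deterministic guarantee under the noise bounds. -/

/-- The noise, as a symmetric matrix with a null diagonal. -/
def noiseMatrix {n : ℕ} (e : Pairs n → ℝ) : Matrix (Fin n) (Fin n) ℝ := observation 0 e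

theorem noiseMatrix_symm {n : ℕ} (e : Pairs n → ℝ) (i j : Fin n) :
    noiseMatrix e i j = noiseMatrix e j i := by
  unfold noiseMatrix observation
  rcases lt_trichotomy i j with h | h | h
  · simp [h, h.not_gt]
  · simp [h]
  · simp [h, h.not_gt]

theorem observation_eq {n : ℕ} {F : Matrix (Fin n) (Fin n) ℝ} (hF : F.IsSymm) (e : Pairs n → ℝ)
    {i j : Fin n} (h : i ≠ j) : observation F e i j = F i j + noiseMatrix e i j := by
  unfold noiseMatrix observation
  rcases lt_or_gt_of_ne h with h | h
  · simp [h]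
  · simp [h, h.not_gt, hF.apply i j]

theorem circleBiLipschitz_of_torusBiLipschitz {n : ℕ} (hn : 0 < n) {cl cL ce : ℝ}
    {F : Matrix (Fin n) (Fin n) ℝ} {σ : Equiv.Perm (Fin n)}
    (h : TorusBiLipschitz cl cL ce (F.submatrix σ.symm σ.symm)) :
    CircleBiLipschitz cl cL (slack ce n) F fun i => torusPoint n (label (σ i)) := by
  have hn' : (0 : ℝ) < n := by exact_mod_cast hn
  have hd : ∀ i j : Fin n, geoDist (torusPoint n (label (σ i))) (torusPoint n (label (σ j))) =
      2 * Real.pi / n * torusDist n (label (σ i)) (label (σ j)) := fun i j => by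
    refine geoDist_torusPoint hn ?_
    have := (σ i).2
    have := (σ j).2
    rw [label, label, abs_le]; omega
  refine ⟨fun i j k => ?_, fun i j k hjk => ?_, fun i k => ?_, fun v => ?_⟩
  · have := h.upper (σ i) (σ j) (σ k)
    simp only [Matrix.submatrix_apply, Equiv.symm_apply_apply] at this
    rw [hd, ← mul_assoc]; exact this
  · rw [hd, hd] at hjk ⊢
    have h1 := le_of_mul_le_mul_left hjk (by have := pi_pos; positivity)
    have := h.lower (σ i) (σ j) (σ k) (by exact_mod_cast h1)
    simp only [Matrix.submatrix_apply, Equiv.symm_apply_apply] at this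
    rw [← mul_sub, ← mul_assoc]; exact this
  -- The latent positions exhaust the `n`-th roots of unity, which are stable under these
  -- reflections.
  · obtain ⟨j, hj⟩ := exists_label_eq hn (label (σ i) + label (σ i) + -label (σ k))
    refine ⟨σ.symm j, ?_⟩
    simp only [Equiv.apply_symm_apply]
    rw [hj, torusPoint_add, torusPoint_add, torusPoint_neg]
  · obtain ⟨m, hm⟩ := exists_torusPoint_near hn v
    obtain ⟨j, hj⟩ := exists_label_eq hn m
    refine ⟨σ.symm j, ?_⟩
    simp only [Equiv.apply_symm_apply]
    rwa [hj]

/-- The control of the noise for the initial localization of the points of `T`, with the oracle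
positions given by `e₀`. -/
def InitNoiseBound {n k : ℕ} {T : Finset (Fin n)} (e₀ : T ≃ Fin k) (w : Pairs n → ℝ) : Prop :=
  ∀ e : T ≃ Fin k,
    ∑ i : T, ∑ j : T, noiseMatrix w i j * (geoDist (gridPoint k (e₀ i)) (gridPoint k (e₀ j)) -
        geoDist (gridPoint k (e i)) (gridPoint k (e j))) ≤
      4 * √(n * Real.log n) * √(∑ i, ∑ j, (geoDist (gridPoint k (e₀ i)) (gridPoint k (e₀ j)) -
        geoDist (gridPoint k (e i)) (gridPoint k (e j))) ^ 2)

/-- The control of the noise for the refinement, given initial positions `x` of the points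
of `T`. -/
def RefineNoiseBound {n : ℕ} (k : ℕ) {T : Finset (Fin n)} (x : T → Circle) (w : Pairs n → ℝ) :
    Prop :=
  ∀ i ∉ T, ∀ p q : Fin k,
    ∑ j : T, noiseMatrix w i j * (geoDist (gridPoint k p) (x j) - geoDist (gridPoint k q) (x j)) ≤
      4 * √(Real.log n) *
        √(∑ j : T, (geoDist (gridPoint k p) (x j) - geoDist (gridPoint k q) (x j)) ^ 2)

/-- The constant in the error of the initial localization. -/
noncomputable def initConst (cl cL ce : ℝ) : ℝ := 2 / cl * (4 + 240 * (cl + cL) + ce / 2)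

/-- The constant in the error of the refined localization. -/
noncomputable def refineConst (cl cL ce : ℝ) : ℝ :=
  40 / cl * (2 + cL * (8 * initConst cl cL ce + 60) + cL + ce + 8 * (cl + cL)) + 13

/-- The refined localization of the points outside `T`, under the noise bounds. -/
theorem localization {n k : ℕ} (hk : 3 ≤ k) (hn : n = 4 * k) {cl cL ce : ℝ} (hcl : 0 < cl)
    (hcL : cl ≤ cL) (hce : 0 ≤ ce) {F : Matrix (Fin n) (Fin n) ℝ} (hF : F.IsSymm)
    {σ : Equiv.Perm (Fin n)} (h : TorusBiLipschitz cl cL ce (F.submatrix σ.symm σ.symm))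
    {T : Finset (Fin n)} (e₀ : T ≃ Fin k)
    (he₀ : ∀ j, geoDist (gridPoint k (e₀ j)) (torusPoint n (label (σ j))) ≤
      2 * Real.pi / k * (8 * √(n * Real.log n) + 1 / 4))
    {w : Pairs n → ℝ} (hw : InitNoiseBound e₀ w) {x : T → Circle} (hx : x ∈ regularTuples T k)
    (hxmin : IsMinOn (initCriterion fun i j : T => observation F w i j) (regularTuples T k) x)
    (hwx : RefineNoiseBound k x w) :
    ∃ Q : ℂ ≃ₗᵢ[ℝ] ℂ, ∀ i ∉ T, ∀ z ∈ grid k,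
      IsMinOn (fun v => ∑ j : T, observation F w i j * geoDist v (x j)) (grid k) z →
      geoDist z (orthAct Q (torusPoint n (label (σ i)))) ≤
        refineConst cl cL ce * √(Real.log n / n) := by
  have : NeZero k := ⟨by omega⟩
  have hpi := pi_pos
  have hpi' : Real.pi ≤ 3.15 := Real.pi_lt_d2.le
  have hcL0 : 0 < cL := hcl.trans_le hcL
  have hn12 : (12 : ℝ) ≤ n := by rw [hn]; exact_mod_cast (by omega)
  have hn0 : (0 : ℝ) < n := by linarith
  have hk0 : (0 : ℝ) < k := by exact_mod_cast (by omega : 0 < k)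
  have hkn : (k : ℝ) = n / 4 := by rw [hn]; push_cast; ring
  have hlog : 1 ≤ Real.log n := by
    rw [Real.le_log_iff_exp_le hn0]
    linarith [Real.exp_one_lt_d9]
  -- The unit of error: `n * l = √(n log n)`, and `1 / n ≤ l` lets discretization errors be
  -- absorbed.
  set l := √(Real.log n / n) with hl
  have hl0 : 0 < l := Real.sqrt_pos.2 (by positivity)
  have hl2 : n * l ^ 2 = Real.log n := by rw [hl, Real.sq_sqrt (by positivity)]; field_simp
  have hL : √(n * Real.log n) = n * l := by
    rw [← hl2, show n * (n * l ^ 2) = (n * l) ^ 2 by ring]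
    exact Real.sqrt_sq (by positivity)
  have hnl : 1 ≤ n * l := by
    rw [← hL, Real.one_le_sqrt]; nlinarith
  have hnl' : 1 / n ≤ l := by rw [div_le_iff₀ hn0]; linarith
  have hbil := circleBiLipschitz_of_torusBiLipschitz (by omega) h
  have hε : slack ce n = ce * l := rfl
  rw [hε] at hbil
  have hε0 : 0 ≤ ce * l := by positivity
  set u : Fin n → Circle := fun i => torusPoint n (label (σ i)) with hu
  rw [InitNoiseBound] at hw
  rw [hL] at he₀ hw
  have hδ : ∀ j : T, geoDist (gridPoint k (e₀ j)) (u j) ≤ 240 * l := fun j => by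
    refine (he₀ j).trans ?_
    rw [hkn]
    calc _ ≤ 2 * 3.15 / (n / 4) * (8 * (n * l) + 1 / 4 * (n * l)) := by gcongr; linarith
      _ = 207.9 * l := by field_simp; norm_num
      _ ≤ _ := by gcongr; norm_num
  obtain ⟨e, he⟩ := hx
  have hxe : x = fun j => gridPoint k (e j) := funext he
  subst hxe
  have hK1 : 0 < initConst cl cL ce := by rw [initConst]; positivity
  -- The diagonal of the observations is zero while that of `F` is arbitrary; it is multiplied by a
  -- null distance.
  have hdiag : ∀ (y : T → Circle), ∑ i : T, ∑ j : T, observation F w i j * geoDist (y i) (y j) =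
      ∑ i : T, ∑ j : T, (F i j + noiseMatrix w i j) * geoDist (y i) (y j) := fun y => by
    refine Finset.sum_congr rfl fun i _ => Finset.sum_congr rfl fun j _ => ?_
    rcases eq_or_ne i j with rfl | hij
    · rw [geoDist_self]; ring
    · rw [observation_eq hF w fun h => hij (Subtype.ext h)]
  have hinit := init_localization hbil hcl hcL0.le hε0 (by positivity) (by positivity) e₀ e hδ
    (fun i j : T => noiseMatrix w i j)
    (by
      have := isMinOn_iff.1 hxmin (fun j => gridPoint k (e₀ j)) ⟨e₀, fun j => rfl⟩
      rw [initCriterion, initCriterion, hdiag, hdiag] at this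
      exact this)
    (hw e)
  have hΨ : 2 / cl * (4 * (n * l) + k * (4 * (cl + cL) * (240 * l) + 2 * (ce * l))) =
      initConst cl cL ce * (n * l) := by
    rw [hkn, initConst]; ring
  rw [hΨ] at hinit
  have hcard : Fintype.card T = k := by simpa using Fintype.card_congr e
  obtain ⟨Q, hQ⟩ := exists_orthAct_sum_sq_le (by omega) hcard _ _ (by positivity) (fun a => by
      rw [Finset.sum_sub_distrib, Finset.sum_const, Finset.card_univ, hcard, nsmul_eq_mul]
      have h1 := sum_inner_gridPoint_sq hk (gridPoint k (e₀ a) : ℂ) 1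
      rw [← Equiv.sum_comp e₀, Circle.norm_coe] at h1
      simp only [one_mul] at h1
      rw [h1]; ring) hinit
  -- Cauchy–Schwarz converts the square-sum bound into a bound on the sum, with `√60 ≤ 8`; the
  -- oracle displacement contributes `k * 240 * l = 60 * n * l`.
  have hΛ : ∑ j : T, geoDist (gridPoint k (e j)) (orthAct Q (u j)) ≤
      (8 * initConst cl cL ce + 60) * (n * l) := by
    have h1 : ∑ j : T, geoDist (gridPoint k (e j)) (orthAct Q (gridPoint k (e₀ j))) ≤
        8 * initConst cl cL ce * (n * l) := by
      refine (abs_le_of_sq_le_sq' ?_ (by positivity)).2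
      refine (sq_sum_le_card_mul_sum_sq).trans ?_
      rw [Finset.card_univ, hcard]
      calc _ ≤ (k : ℝ) * (60 * (initConst cl cL ce * (n * l)) ^ 2 / k) := by gcongr
        _ = 60 * (initConst cl cL ce * (n * l)) ^ 2 := by field_simp
        _ ≤ _ := by nlinarith [sq_nonneg (initConst cl cL ce * (n * l))]
    have h2 : ∀ j : T, geoDist (gridPoint k (e j)) (orthAct Q (u j)) ≤
        geoDist (gridPoint k (e j)) (orthAct Q (gridPoint k (e₀ j))) + 240 * l := fun j => by
      refine (geoDist_triangle _ (orthAct Q (gridPoint k (e₀ j))) _).trans ?_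
      rw [geoDist_orthAct]
      linarith [hδ j]
    refine (Finset.sum_le_sum fun j _ => h2 j).trans ?_
    rw [Finset.sum_add_distrib, Finset.sum_const, Finset.card_univ, hcard, nsmul_eq_mul, hkn]
    linarith
  refine ⟨Q, fun i hi z hz hzmin => ?_⟩
  obtain ⟨q, rfl⟩ := hz
  obtain ⟨p, hp⟩ := exists_gridPoint_near (by omega : 0 < k) (orthAct Q (u i))
  rw [geoDist_comm] at hp
  have hij : ∀ j : T, observation F w i j = F i j + noiseMatrix w i j := fun j =>
    observation_eq hF w fun h => hi (h ▸ j.2)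
  have hsq : √(Real.log n) * √(k : ℝ) = n * l / 2 := by
    rw [← Real.sqrt_mul (by linarith), hkn, ← hl2,
      show n * l ^ 2 * (n / 4) = (n * l / 2) ^ 2 by ring]
    exact Real.sqrt_sq (by positivity)
  have hfin := refine_localization hk hbil hcl hcL0.le hε0 (by positivity : 0 ≤ 2 * (n * l)) e Q hΛ
    i p q hp (fun j => noiseMatrix w i j)
    (by
      have := isMinOn_iff.1 hzmin (gridPoint k p) ⟨p, rfl⟩
      simpa only [hij] using this)
    (by
      refine (hwx i hi p q).trans ?_
      set ζ := geoDist (gridPoint k q) (gridPoint k p)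
      have hζ : 0 ≤ ζ := geoDist_nonneg _ _
      have h1 : √(∑ j : T, (geoDist (gridPoint k p) (gridPoint k (e j)) -
          geoDist (gridPoint k q) (gridPoint k (e j))) ^ 2) ≤ √k * ζ := by
        rw [Real.sqrt_le_left (by positivity), mul_pow, Real.sq_sqrt hk0.le]
        refine (Finset.sum_le_card_nsmul _ _ (ζ ^ 2) fun j _ => ?_).trans (le_of_eq ?_)
        · refine sq_le_sq.2 ?_
          rw [abs_of_nonneg hζ, abs_sub_comm]
          exact abs_geoDist_sub_le _ _ _
        · rw [Finset.card_univ, hcard, nsmul_eq_mul]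
      calc _ ≤ 4 * √(Real.log n) * (√k * ζ) := by gcongr
        _ = 4 * (√(Real.log n) * √k) * ζ := by ring
        _ = _ := by rw [hsq]; ring)
  have hζ : geoDist (gridPoint k q) (gridPoint k p) ≤ 40 / cl *
      (2 + cL * (8 * initConst cl cL ce + 60) + cL + ce + 8 * (cl + cL)) * l := by
    have e1 : (k : ℝ) * (cL * (Real.pi / n) + ce * l) ≤ (n * l) * (cL + ce / 4) := by
      rw [hkn]
      have : cL * (Real.pi / n) ≤ cL * (4 * l) := by
        gcongr
        calc Real.pi / n = Real.pi * (1 / n) := by ring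
          _ ≤ 4 * l := by gcongr; linarith
      calc _ ≤ (n : ℝ) / 4 * (cL * (4 * l) + ce * l) := by gcongr
        _ = _ := by ring
    have e2 : (k : ℝ) * (2 * (cl + cL) * (Real.pi / k + Real.pi / n) + 2 * (ce * l)) ≤
        (n * l) * (8 * (cl + cL) + ce / 2) := by
      rw [hkn]
      have : Real.pi / (n / 4) + Real.pi / n ≤ 16 * l := by
        calc Real.pi / ((n : ℝ) / 4) + Real.pi / n = 5 * Real.pi * (1 / n) := by field_simp; norm_num
          _ ≤ 16 * l := by gcongr; linarith
      calc _ ≤ (n : ℝ) / 4 * (2 * (cl + cL) * (16 * l) + 2 * (ce * l)) := by gcongr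
        _ = _ := by ring
    rw [hkn] at hfin
    have e3 : cl * (n / 4) / 10 * geoDist (gridPoint k q) (gridPoint k p) ≤ (n * l) *
        (2 + cL * (8 * initConst cl cL ce + 60) + cL + ce + 8 * (cl + cL)) := by
      rw [hkn] at e1 e2
      have : 0 ≤ n * l * ce := by positivity
      linarith
    have e4 : (0 : ℝ) < cl * (n / 4) / 10 := by positivity
    refine le_of_mul_le_mul_left (e3.trans (le_of_eq ?_)) e4
    field_simp; norm_num
  have hpk : Real.pi / k ≤ 13 * l := by
    rw [hkn]
    calc Real.pi / ((n : ℝ) / 4) = 4 * Real.pi * (1 / n) := by field_simp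
      _ ≤ 13 * l := by gcongr; linarith
  have := geoDist_triangle (gridPoint k q) (gridPoint k p) (orthAct Q (u i))
  rw [refineConst]
  linarith

/-- The deterministic guarantee of the procedure, under the noise bounds. -/
theorem exists_symmetryGroup_of_isOutput {n k : ℕ} (hk : 3 ≤ k) (hn : n = 4 * k) {cl cL ce : ℝ}
    (hcl : 0 < cl) (hcL : cl ≤ cL) (hce : 0 ≤ ce) {F : Matrix (Fin n) (Fin n) ℝ} (hF : F.IsSymm)
    {σ : Equiv.Perm (Fin n)} (h : TorusBiLipschitz cl cL ce (F.submatrix σ.symm σ.symm))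
    {init init' : (T : Finset (Fin n)) → (T → T → ℝ) → (T → Circle)}
    (hinit : IsInitRule init) (hinit' : IsInitRule init')
    {S S' : Finset (Fin n)} (hdisj : Disjoint S S') (e : S ≃ Fin k) (e' : S' ≃ Fin k)
    (he : ∀ j, geoDist (gridPoint k (e j)) (torusPoint n (label (σ j))) ≤
      2 * Real.pi / k * (8 * √(n * Real.log n) + 1 / 4))
    (he' : ∀ j, geoDist (gridPoint k (e' j)) (torusPoint n (label (σ j))) ≤
      2 * Real.pi / k * (8 * √(n * Real.log n) + 1 / 4))
    {w : Pairs n → ℝ} (hw : InitNoiseBound e w) (hw' : InitNoiseBound e' w)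
    (hr : RefineNoiseBound k (init S fun i j => observation F w i j) w)
    (hr' : RefineNoiseBound k (init' S' fun i j => observation F w i j) w)
    {x : Fin n → Circle} (hx : IsOutput init init' (observation F w) S S' x) :
    ∃ τ ∈ symmetryGroup n, ∀ i, (torusDist n (label (τ (σ i))) (sigmaHat x i) : ℝ)
      ≤ (7 * refineConst cl cL ce + 8) * √(n * Real.log n) := by
  have hpi := pi_pos
  have hn4 : n / 4 = k := by omega
  have hS : S.card = n / 4 := by rw [hn4]; simpa using Fintype.card_congr e
  have hS' : S'.card = n / 4 := by rw [hn4]; simpa using Fintype.card_congr e'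
  obtain ⟨y, y', Q, hy, hy', hQ, hxy, hxy'⟩ := hx
  unfold IsRefined at hy hy'
  have m1 := hinit.mem S hS
  have m2 := hinit'.mem S' hS'
  have m3 := hinit.isMinOn S hS
  have m4 := hinit'.isMinOn S' hS'
  rw [hn4] at m1 m2 m3 m4 hy hy'
  obtain ⟨Q₁, hQ₁⟩ := localization hk hn hcl hcL hce hF h e he hw (m1 _) (m3 _) hr
  obtain ⟨Q₂, hQ₂⟩ := localization hk hn hcl hcL hce hF h e' he' hw' (m2 _) (m4 _) hr'
  have hcL0 : 0 < cL := hcl.trans_le hcL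
  have hn12 : (12 : ℝ) ≤ n := by rw [hn]; exact_mod_cast (by omega)
  have hn0 : (0 : ℝ) < n := by linarith
  have hlog : 1 ≤ Real.log n := by
    rw [Real.le_log_iff_exp_le hn0]
    linarith [Real.exp_one_lt_d9]
  set l := √(Real.log n / n) with hl
  have hl0 : 0 < l := Real.sqrt_pos.2 (by positivity)
  have hL : √(n * Real.log n) = n * l := by
    have hl2 : n * l ^ 2 = Real.log n := by rw [hl, Real.sq_sqrt (by positivity)]; field_simp
    rw [← hl2, show n * (n * l ^ 2) = (n * l) ^ 2 by ring]
    exact Real.sqrt_sq (by positivity)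
  have hnl : 1 ≤ n * l := by
    rw [← hL, Real.one_le_sqrt]; nlinarith
  have hK : 0 < refineConst cl cL ce := by
    have : 0 < initConst cl cL ce := by rw [initConst]; positivity
    rw [refineConst]; positivity
  -- As labels start at 1, the latent positions form the `n`-grid rotated by one step.
  have hu : ∀ i : Fin n, ∑ j, (inner ℝ (torusPoint n (label (σ i)) : ℂ)
      (torusPoint n (label (σ j)) : ℂ)) ^ 4 = 3 * (n : ℝ) / 8 := fun i => by
    rw [Equiv.sum_comp σ fun j => (inner ℝ (torusPoint n (label (σ i)) : ℂ)
      (torusPoint n (label j) : ℂ)) ^ 4]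
    rw [← sum_inner_gridPoint_pow_four (k := n) (by omega) (torusPoint n (label (σ i)))
      (torusPoint n 1)]
    refine Finset.sum_congr rfl fun j _ => ?_
    have : torusPoint n (label j) = torusPoint n 1 * gridPoint n j := by
      rw [label, torusPoint_add, gridPoint_eq_torusPoint, mul_comm]
    rw [this]
  have hmerge := merge_localization hdisj (by omega) (by omega) hu (by positivity)
    (fun i hi => hQ₁ i hi _ (hy i hi).1 (hy i hi).2)
    (fun i hi => hQ₂ i hi _ (hy' i hi).1 (hy' i hi).2) hQ hxy hxy'
  obtain ⟨τ, hτ, hτ'⟩ := exists_symmetryGroup_torusDist_le (by omega) σ x Q₁ hmerge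
  refine ⟨τ, hτ, fun i => ?_⟩
  have h1 := hτ' i
  rw [hL]
  have hpi3 := Real.pi_gt_three
  have h2 : (torusDist n (label (τ (σ i))) (sigmaHat x i) : ℝ) ≤
      n / (2 * Real.pi) * (37 * (refineConst cl cL ce * l) + 3 * Real.pi / n) := by
    refine le_trans (le_of_eq ?_) (mul_le_mul_of_nonneg_left h1 (by positivity))
    field_simp
  refine h2.trans ?_
  calc _ = 37 * refineConst cl cL ce * (n * l) / (2 * Real.pi) + 3 / 2 * 1 := by field_simp
    _ ≤ 37 * refineConst cl cL ce * (n * l) / (2 * 3) + 3 / 2 * (n * l) := by gcongr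
    _ ≤ _ := by
      have : 0 < refineConst cl cL ce * (n * l) := by positivity
      linarith

/-! ### Tail bounds for the noise and union bounds. -/

theorem sum_sum_eq_two_mul_sum_pairs {n : ℕ} (f : Fin n → Fin n → ℝ)
    (hf : ∀ i j, f i j = f j i) : ∑ i, ∑ j, f i j = 2 * ∑ p : Pairs n, f p.1.1 p.1.2 + ∑ i, f i i := by
  have h1 : ∑ p : Pairs n, f p.1.1 p.1.2 = ∑ i, ∑ j, if i < j then f i j else 0 := by
    rw [← Fintype.sum_prod_type' (f := fun i j => if i < j then f i j else 0), ← Finset.sum_filter,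
      Finset.sum_subtype _ (p := fun p : Fin n × Fin n => p.1 < p.2) (by simp)
        (fun p => f p.1 p.2)]
  have h2 : ∑ p : Pairs n, f p.1.1 p.1.2 = ∑ i, ∑ j, if j < i then f i j else 0 := by
    rw [h1, Finset.sum_comm]
    exact Finset.sum_congr rfl fun i _ => Finset.sum_congr rfl fun j _ => by rw [hf]
  have h3 : ∑ i, f i i = ∑ i, ∑ j, if i = j then f i j else 0 :=
    Finset.sum_congr rfl fun i _ => by simp
  rw [two_mul]
  nth_rw 1 [h1]
  rw [h2, h3, ← Finset.sum_add_distrib, ← Finset.sum_add_distrib]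
  refine Finset.sum_congr rfl fun i _ => ?_
  rw [← Finset.sum_add_distrib, ← Finset.sum_add_distrib]
  refine Finset.sum_congr rfl fun j _ => ?_
  rcases lt_trichotomy i j with h | h | h
  · simp [h, h.not_gt, h.ne]
  · simp [h]
  · simp [h, h.not_gt, h.ne']

/-- Tail bound for a linear form of the noise matrix. -/
theorem noiseMatrix_tail {n : ℕ} {Ω : Type*} [MeasurableSpace Ω] {μ : Measure Ω}
    [IsProbabilityMeasure μ] {E : Pairs n → Ω → ℝ} (hE : IsSubGaussianNoise μ E)
    (M : Fin n → Fin n → ℝ) (hM : ∀ i j, M i j = M j i) {s : ℝ} (hs : 0 ≤ s) :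
    μ.real {ω | s * √(∑ i, ∑ j, M i j ^ 2) <
      ∑ i, ∑ j, noiseMatrix (fun p => E p ω) i j * M i j} ≤ Real.exp (-s ^ 2 / 4) := by
  -- Each pair occurs twice in the double sum. The coefficients `2 * M` have squared norm at most
  -- twice that of `M`, whence the level `s / √2` and the exponent `s² / 4`.
  have h := hE.tail (fun p => 2 * M p.1.1 p.1.2) (s / √2) (by positivity)
  have e : (s / √2) ^ 2 = s ^ 2 / 2 := by rw [div_pow, Real.sq_sqrt (by norm_num)]
  rw [e, show -(s ^ 2 / 2) / 2 = -s ^ 2 / 4 by ring] at h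
  refine le_trans (measureReal_mono fun ω hω => ?_) h
  rw [Set.mem_ofPred_eq] at hω ⊢
  have h1 : ∑ i, ∑ j, noiseMatrix (fun p => E p ω) i j * M i j =
      ∑ p : Pairs n, 2 * M p.1.1 p.1.2 * E p ω := by
    rw [sum_sum_eq_two_mul_sum_pairs _ fun i j => by rw [noiseMatrix_symm, hM], Finset.mul_sum]
    have h0 : ∀ i, noiseMatrix (fun p => E p ω) i i = 0 := fun i => by
      simp [noiseMatrix, observation]
    simp only [h0, zero_mul, Finset.sum_const_zero, add_zero]
    refine Finset.sum_congr rfl fun p _ => ?_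
    have : noiseMatrix (fun p => E p ω) p.1.1 p.1.2 = E p ω := by
      simp [noiseMatrix, observation, p.2]
    rw [this]; ring
  have h2 : ∑ p : Pairs n, (2 * M p.1.1 p.1.2) ^ 2 ≤ 2 * ∑ i, ∑ j, M i j ^ 2 := by
    rw [sum_sum_eq_two_mul_sum_pairs (fun i j => M i j ^ 2) fun i j => by rw [hM]]
    have : 0 ≤ ∑ i, M i i ^ 2 := Finset.sum_nonneg fun i _ => sq_nonneg _
    simp only [mul_pow]
    rw [← Finset.mul_sum]
    linarith
  rw [h1] at hω
  refine lt_of_le_of_lt ?_ hω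
  calc s / √2 * √(∑ p : Pairs n, (2 * M p.1.1 p.1.2) ^ 2)
      ≤ s / √2 * √(2 * ∑ i, ∑ j, M i j ^ 2) := by gcongr
    _ = _ := by rw [Real.sqrt_mul (by norm_num)]; field_simp

theorem sum_subtype_eq_sum_dite {ι : Type*} [Fintype ι] [DecidableEq ι] (T : Finset ι)
    (f : T → ℝ) : ∑ i : T, f i = ∑ i, if h : i ∈ T then f ⟨i, h⟩ else 0 := by
  rw [← Finset.sum_subset (Finset.subset_univ T) fun i _ hi => by simp [hi], ← Finset.sum_attach T, Finset.univ_eq_attach]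
  exact Finset.sum_congr rfl fun i _ => by simp

theorem noiseMatrix_tail_block {n : ℕ} {Ω : Type*} [MeasurableSpace Ω] {μ : Measure Ω}
    [IsProbabilityMeasure μ] {E : Pairs n → Ω → ℝ} (hE : IsSubGaussianNoise μ E)
    {T : Finset (Fin n)} (g : T → T → ℝ) (hg : ∀ i j, g i j = g j i) {s : ℝ} (hs : 0 ≤ s) :
    μ.real {ω | s * √(∑ i, ∑ j, g i j ^ 2) <
      ∑ i : T, ∑ j : T, noiseMatrix (fun p => E p ω) i j * g i j} ≤ Real.exp (-s ^ 2 / 4) := by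
  let M : Fin n → Fin n → ℝ := fun i j =>
    if hi : i ∈ T then (if hj : j ∈ T then g ⟨i, hi⟩ ⟨j, hj⟩ else 0) else 0
  have key : ∀ (φ : ℝ → Fin n → Fin n → ℝ), (∀ i j, φ 0 i j = 0) →
      ∑ i : T, ∑ j : T, φ (g i j) i j = ∑ i, ∑ j, φ (M i j) i j := fun φ hφ => by
    rw [sum_subtype_eq_sum_dite]
    refine Finset.sum_congr rfl fun i _ => ?_
    split_ifs with hi
    · rw [sum_subtype_eq_sum_dite]
      refine Finset.sum_congr rfl fun j _ => ?_
      split_ifs with hj <;> simp [M, hi, hj, hφ]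
    · simp [M, hi, hφ]
  have h := noiseMatrix_tail hE M (fun i j => by
    by_cases hi : i ∈ T <;> by_cases hj : j ∈ T <;> simp [M, hi, hj, hg]) hs
  have e : ∀ ω, ∑ i : T, ∑ j : T, noiseMatrix (fun p => E p ω) i j * g i j =
      ∑ i, ∑ j, noiseMatrix (fun p => E p ω) i j * M i j := fun ω =>
    key (fun x i j => noiseMatrix (fun p => E p ω) i j * x) (by simp)
  rw [← key (fun x _ _ => x ^ 2) (by simp)] at h
  simpa only [e] using h

/-- Place `g` symmetrically in row and column `i`. As `i ∉ T` these do not overlap, so both the form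
and the squared norm double; level `√2 * s` restores the exponent `s² / 2`. -/
theorem noiseMatrix_tail_row {n : ℕ} {Ω : Type*} [MeasurableSpace Ω] {μ : Measure Ω}
    [IsProbabilityMeasure μ] {E : Pairs n → Ω → ℝ} (hE : IsSubGaussianNoise μ E)
    {T : Finset (Fin n)} {i : Fin n} (hi : i ∉ T) (g : T → ℝ) {s : ℝ} (hs : 0 ≤ s) :
    μ.real {ω | s * √(∑ j, g j ^ 2) <
      ∑ j : T, noiseMatrix (fun p => E p ω) i j * g j} ≤ Real.exp (-s ^ 2 / 2) := by
  let β : Fin n → ℝ := fun j => if hj : j ∈ T then g ⟨j, hj⟩ else 0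
  have hβi : β i = 0 := by simp [β, hi]
  let M : Fin n → Fin n → ℝ := fun a b => (if a = i then β b else 0) + (if b = i then β a else 0)
  have h := noiseMatrix_tail hE M (fun a b => add_comm _ _) (s := √2 * s) (by positivity)
  have e1 : ∑ a, ∑ b, M a b ^ 2 = 2 * ∑ j, g j ^ 2 := by
    have : ∀ a b, M a b ^ 2 = (if a = i then β b ^ 2 else 0) + (if b = i then β a ^ 2 else 0) :=
      fun a b => by
        by_cases ha : a = i <;> by_cases hb : b = i <;> simp [M, ha, hb, hβi]
    simp only [this, Finset.sum_add_distrib]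
    rw [Finset.sum_comm]
    simp only [Finset.sum_ite_eq', Finset.mem_univ, if_true]
    rw [sum_subtype_eq_sum_dite, two_mul]
    have : ∀ j, β j ^ 2 = if h : j ∈ T then g ⟨j, h⟩ ^ 2 else 0 := fun j => by
      by_cases hj : j ∈ T <;> simp [β, hj]
    simp only [this]
  have e2 : ∀ ω, ∑ a, ∑ b, noiseMatrix (fun p => E p ω) a b * M a b =
      2 * ∑ j : T, noiseMatrix (fun p => E p ω) i j * g j := fun ω => by
    have : ∀ a b, noiseMatrix (fun p => E p ω) a b * M a b =
        (if a = i then noiseMatrix (fun p => E p ω) i b * β b else 0) +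
        (if b = i then noiseMatrix (fun p => E p ω) i a * β a else 0) := fun a b => by
      by_cases ha : a = i <;> by_cases hb : b = i <;> simp [M, ha, hb, hβi]
      rw [noiseMatrix_symm]; simp
    simp only [this, Finset.sum_add_distrib]
    rw [Finset.sum_comm]
    simp only [Finset.sum_ite_eq', Finset.mem_univ, if_true]
    rw [sum_subtype_eq_sum_dite T fun j => noiseMatrix (fun p => E p ω) i j * g j, two_mul]
    have : ∀ j, noiseMatrix (fun p => E p ω) i j * β j =
        if h : j ∈ T then noiseMatrix (fun p => E p ω) i j * g ⟨j, h⟩ else 0 := fun j => by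
      by_cases hj : j ∈ T <;> simp [β, hj]
    simp only [this]
  have h2 : (√2 : ℝ) ^ 2 = 2 := Real.sq_sqrt (by norm_num)
  simp only [e1, e2] at h
  rw [mul_pow, h2, show -(2 * s ^ 2) / 4 = -s ^ 2 / 2 by ring] at h
  refine le_trans (measureReal_mono fun ω hω => ?_) h
  rw [Set.mem_ofPred_eq] at hω ⊢
  rw [Real.sqrt_mul (by norm_num)]
  calc _ = (√2) ^ 2 * (s * √(∑ j, g j ^ 2)) := by ring
    _ = 2 * (s * √(∑ j, g j ^ 2)) := by rw [h2]
    _ < _ := by linarith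

theorem exp_neg_mul_log {n : ℕ} (hn : 0 < n) (m : ℕ) :
    Real.exp (-(m * Real.log n)) = 1 / (n : ℝ) ^ m := by
  rw [Real.exp_neg, Real.exp_nat_mul, Real.exp_log (by exact_mod_cast hn), one_div]

/-- The level `4√(n log n)` gives each enumeration failure probability at most `n^(-4n)`, which
beats their number `k! ≤ n^n`. -/
theorem measureReal_not_initNoiseBound_le {n k : ℕ} (hn : n = 4 * k) (hk : 1 ≤ k) {Ω : Type*} [MeasurableSpace Ω]
    {μ : Measure Ω} [IsProbabilityMeasure μ] {E : Pairs n → Ω → ℝ} (hE : IsSubGaussianNoise μ E)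
    {T : Finset (Fin n)} (e₀ : T ≃ Fin k) :
    μ.real {ω | ¬ InitNoiseBound e₀ fun p => E p ω} ≤ 1 / (2 * (n : ℝ) ^ 2) := by
  classical
  have hn4 : (4 : ℝ) ≤ n := by rw [hn]; exact_mod_cast (by omega)
  let Bad : (T ≃ Fin k) → Set Ω := fun e => {ω |
    4 * √(n * Real.log n) * √(∑ i, ∑ j, (geoDist (gridPoint k (e₀ i)) (gridPoint k (e₀ j)) -
        geoDist (gridPoint k (e i)) (gridPoint k (e j))) ^ 2) <
    ∑ i : T, ∑ j : T, noiseMatrix (fun p => E p ω) i j *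
      (geoDist (gridPoint k (e₀ i)) (gridPoint k (e₀ j)) -
        geoDist (gridPoint k (e i)) (gridPoint k (e j)))}
  have hBad : ∀ e, μ.real (Bad e) ≤ 1 / (n : ℝ) ^ (4 * n) := fun e => by
    refine (noiseMatrix_tail_block hE (fun i j => geoDist (gridPoint k (e₀ i)) (gridPoint k (e₀ j)) -
        geoDist (gridPoint k (e i)) (gridPoint k (e j))) (fun i j => by
          rw [geoDist_comm, geoDist_comm (gridPoint k (e i))]) (by positivity)).trans ?_
    rw [← exp_neg_mul_log (by omega), mul_pow, Real.sq_sqrt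
      (mul_nonneg (by linarith) (Real.log_nonneg (by linarith)))]
    refine le_of_eq ?_
    congr 1; push_cast; ring
  have hsub : {ω | ¬ InitNoiseBound e₀ fun p => E p ω} ⊆ ⋃ e ∈ Finset.univ, Bad e := fun ω hω => by
    rw [Set.mem_ofPred_eq, InitNoiseBound] at hω
    push Not at hω
    simpa [Bad] using hω
  have hcard : (Fintype.card (T ≃ Fin k) : ℝ) ≤ (n : ℝ) ^ n := by
    have h1 : Fintype.card (T ≃ Fin k) ≤ n ^ n := by
      rw [Fintype.card_equiv e₀, Fintype.card_congr e₀, Fintype.card_fin]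
      calc k.factorial ≤ n.factorial := Nat.factorial_le (by omega)
        _ ≤ n ^ n := Nat.factorial_le_pow n
    exact_mod_cast h1
  calc _ ≤ μ.real (⋃ e ∈ Finset.univ, Bad e) := measureReal_mono hsub (measure_ne_top _ _)
    _ ≤ ∑ e : T ≃ Fin k, μ.real (Bad e) := measureReal_biUnion_finset_le _ _
    _ ≤ ∑ e : T ≃ Fin k, 1 / (n : ℝ) ^ (4 * n) := Finset.sum_le_sum fun e _ => hBad e
    _ = Fintype.card (T ≃ Fin k) * (1 / (n : ℝ) ^ (4 * n)) := by
      rw [Finset.sum_const, Finset.card_univ, nsmul_eq_mul]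
    _ ≤ (n : ℝ) ^ n * (1 / (n : ℝ) ^ (4 * n)) := by gcongr
    _ = 1 / (n : ℝ) ^ (3 * n) := by
      rw [show 4 * n = n + 3 * n by ring, pow_add]; field_simp
    _ ≤ 1 / (2 * (n : ℝ) ^ 2) := by
      have : 2 * (n : ℝ) ^ 2 ≤ (n : ℝ) ^ 3 := by rw [pow_succ _ 2]; nlinarith [sq_nonneg (n : ℝ)]
      refine one_div_le_one_div_of_le (by positivity) (this.trans ?_)
      exact pow_le_pow_right₀ (by linarith) (by omega)

/-- For fixed positions `x`: a union bound over `n * k²` triples, each failing with probability at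
most `n⁻⁸`. -/
theorem measureReal_not_refineNoiseBound_le {n k : ℕ} (hn : n = 4 * k) (hk : 1 ≤ k) {Ω : Type*}
    [MeasurableSpace Ω] {μ : Measure Ω} [IsProbabilityMeasure μ] {E : Pairs n → Ω → ℝ}
    (hE : IsSubGaussianNoise μ E) {T : Finset (Fin n)} (x : T → Circle) :
    μ.real {ω | ¬ RefineNoiseBound k x fun p => E p ω} ≤ 1 / (2 * (n : ℝ) ^ 2) := by
  classical
  have hn4 : (4 : ℝ) ≤ n := by rw [hn]; exact_mod_cast (by omega)
  let g : Fin k × Fin k → T → ℝ := fun c j =>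
    geoDist (gridPoint k c.1) (x j) - geoDist (gridPoint k c.2) (x j)
  let Bad : Fin n × Fin k × Fin k → Set Ω := fun c => {ω | c.1 ∉ T ∧
    4 * √(Real.log n) * √(∑ j, g c.2 j ^ 2) <
    ∑ j : T, noiseMatrix (fun p => E p ω) c.1 j * g c.2 j}
  have hBad : ∀ c, μ.real (Bad c) ≤ 1 / (n : ℝ) ^ 8 := fun c => by
    by_cases hc : c.1 ∈ T
    · simp only [Bad, hc, not_true_eq_false, false_and, Set.ofPred_false, measureReal_empty]
      positivity
    · refine (measureReal_mono fun ω hω => hω.2).trans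
        ((noiseMatrix_tail_row hE hc (g c.2) (by positivity)).trans ?_)
      rw [← exp_neg_mul_log (by omega), mul_pow, Real.sq_sqrt (Real.log_nonneg (by linarith))]
      refine le_of_eq ?_
      congr 1; push_cast; ring
  have hsub : {ω | ¬ RefineNoiseBound k x fun p => E p ω} ⊆ ⋃ c ∈ Finset.univ, Bad c :=
    fun ω hω => by
    rw [Set.mem_ofPred_eq, RefineNoiseBound] at hω
    push Not at hω
    obtain ⟨i, hi, p, q, h⟩ := hω
    exact Set.mem_biUnion (Finset.mem_univ (i, p, q)) ⟨hi, h⟩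
  have hkn : (k : ℝ) ≤ n := by exact_mod_cast (by omega)
  calc _ ≤ μ.real (⋃ c ∈ Finset.univ, Bad c) := measureReal_mono hsub (measure_ne_top _ _)
    _ ≤ ∑ c, μ.real (Bad c) := measureReal_biUnion_finset_le _ _
    _ ≤ ∑ c : Fin n × Fin k × Fin k, 1 / (n : ℝ) ^ 8 := Finset.sum_le_sum fun c _ => hBad c
    _ = n * (k * k) * (1 / (n : ℝ) ^ 8) := by
      rw [Finset.sum_const, Finset.card_univ, nsmul_eq_mul]; simp
    _ ≤ n * (n * n) * (1 / (n : ℝ) ^ 8) := by gcongr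
    _ = 1 / (n : ℝ) ^ 5 := by field_simp
    _ ≤ 1 / (2 * (n : ℝ) ^ 2) := by
      have : 2 * (n : ℝ) ^ 2 ≤ (n : ℝ) ^ 3 := by rw [pow_succ _ 2]; nlinarith [sq_nonneg (n : ℝ)]
      refine one_div_le_one_div_of_le (by positivity) (this.trans ?_)
      exact pow_le_pow_right₀ (by linarith) (by omega)

/-! ### Measurability, and independence of the initial positions from the refinement noise. -/

theorem measurable_observation {n : ℕ} (F : Matrix (Fin n) (Fin n) ℝ) (i j : Fin n) :
    Measurable fun w : Pairs n → ℝ => observation F w i j := by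
  unfold observation
  split_ifs
  · exact (measurable_pi_apply _).const_add _
  · exact (measurable_pi_apply _).const_add _
  · exact measurable_const

theorem measurableSet_initNoiseBound {n k : ℕ} {T : Finset (Fin n)} (e₀ : T ≃ Fin k) :
    MeasurableSet {w : Pairs n → ℝ | InitNoiseBound e₀ w} := by
  unfold InitNoiseBound
  simp only [Set.ofPred_forall]
  refine MeasurableSet.iInter fun e => measurableSet_le ?_ measurable_const
  exact Finset.measurable_fun_sum _ fun i _ => Finset.measurable_fun_sum _ fun j _ =>
    (measurable_observation _ _ _).mul_const _

theorem measurableSet_refineNoiseBound {n k : ℕ} {T : Finset (Fin n)} (x : T → Circle) :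
    MeasurableSet {w : Pairs n → ℝ | RefineNoiseBound k x w} := by
  unfold RefineNoiseBound
  simp only [Set.ofPred_forall]
  refine MeasurableSet.iInter fun i => MeasurableSet.iInter fun _ => MeasurableSet.iInter fun p =>
    MeasurableSet.iInter fun q => measurableSet_le ?_ measurable_const
  exact Finset.measurable_fun_sum _ fun j _ => (measurable_observation _ _ _).mul_const _

theorem measurableSet_init_eq {n : ℕ} {F : Matrix (Fin n) (Fin n) ℝ}
    {init : (T : Finset (Fin n)) → (T → T → ℝ) → (T → Circle)} (hinit : IsInitRule init)
    {T : Finset (Fin n)} (hT : T.card = n / 4) (x : T → Circle) :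
    MeasurableSet {w : Pairs n → ℝ | init T (fun i j => observation F w i j) = x} :=
  (measurable_pi_lambda _ fun _ => measurable_pi_lambda _ fun _ => measurable_observation F _ _)
    (hinit.measurable T hT x)

/-- The event that the noise bound of the refinement fails, split according to the initial
positions. -/
theorem not_refineNoiseBound_init_eq {n k : ℕ} (hn : n / 4 = k) {F : Matrix (Fin n) (Fin n) ℝ}
    {init : (T : Finset (Fin n)) → (T → T → ℝ) → (T → Circle)} (hinit : IsInitRule init)
    {T : Finset (Fin n)} (hT : T.card = n / 4) (D : Finset (T → Circle))
    (hD : ∀ x, x ∈ D ↔ ∃ e : T ≃ Fin k, x = fun j => gridPoint k (e j)) :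
    {w : Pairs n → ℝ | ¬ RefineNoiseBound k (init T fun i j => observation F w i j) w} =
      ⋃ x ∈ D, {w | init T (fun i j => observation F w i j) = x} ∩
        {w | ¬ RefineNoiseBound k x w} := by
  ext w
  simp only [Set.mem_ofPred_eq, Set.mem_iUnion, Set.mem_inter_iff]
  constructor
  · intro h
    obtain ⟨e, he⟩ := hinit.mem T hT fun i j => observation F w i j
    subst hn
    exact ⟨_, (hD _).2 ⟨e, funext he⟩, rfl, h⟩
  · rintro ⟨x, -, rfl, h⟩
    exact h

open Classical in
/-- The regular positions, as a finite set. -/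
noncomputable def regularFinset {n : ℕ} (T : Finset (Fin n)) (k : ℕ) : Finset (T → Circle) :=
  Finset.univ.image fun e : T ≃ Fin k => fun j => gridPoint k (e j)

theorem mem_regularFinset {n k : ℕ} {T : Finset (Fin n)} (x : T → Circle) :
    x ∈ regularFinset T k ↔ ∃ e : T ≃ Fin k, x = fun j => gridPoint k (e j) := by
  simp [regularFinset, eq_comm]

theorem measurableSet_not_refineNoiseBound_init {n k : ℕ} (hn : n / 4 = k)
    {F : Matrix (Fin n) (Fin n) ℝ}
    {init : (T : Finset (Fin n)) → (T → T → ℝ) → (T → Circle)} (hinit : IsInitRule init)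
    {T : Finset (Fin n)} (hT : T.card = n / 4) :
    MeasurableSet
      {w : Pairs n → ℝ | ¬ RefineNoiseBound k (init T fun i j => observation F w i j) w} := by
  rw [not_refineNoiseBound_init_eq hn hinit hT (regularFinset T k) mem_regularFinset]
  exact Finset.measurableSet_biUnion _ fun x _ =>
    (measurableSet_init_eq hinit hT x).inter (measurableSet_refineNoiseBound x).compl

/-- The extension by zero of a family indexed by a finset. -/
noncomputable def extendZero {ι : Type*} [DecidableEq ι] (A : Finset ι) (r : A → ℝ) (p : ι) : ℝ :=
  if h : p ∈ A then r ⟨p, h⟩ else 0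

theorem measurable_extendZero {ι : Type*} [DecidableEq ι] (A : Finset ι) :
    Measurable (extendZero A) := by
  refine measurable_pi_lambda _ fun p => ?_
  unfold extendZero
  split_ifs
  · exact measurable_pi_apply _
  · exact measurable_const

/-- The noise bound of the refinement, when the initial positions are computed from the block of
the observations indexed by `T`. -/
theorem measureReal_not_refineNoiseBound_init_le {n k : ℕ} (hn : n = 4 * k) (hk : 1 ≤ k)
    {Ω : Type*} [MeasurableSpace Ω] {μ : Measure Ω} [IsProbabilityMeasure μ]
    {E : Pairs n → Ω → ℝ} (hE : IsSubGaussianNoise μ E) {F : Matrix (Fin n) (Fin n) ℝ}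
    {init : (T : Finset (Fin n)) → (T → T → ℝ) → (T → Circle)} (hinit : IsInitRule init)
    {T : Finset (Fin n)} (hT : T.card = n / 4) :
    μ.real {ω | ¬ RefineNoiseBound k
      (init T fun i j => observation F (fun p => E p ω) i j) fun p => E p ω} ≤
        1 / (2 * (n : ℝ) ^ 2) := by
  classical
  -- The initial positions depend only on pairs inside `T`, and the refinement of an item outside
  -- `T` only on the other pairs.
  let A : Finset (Pairs n) := Finset.univ.filter fun p => p.1.1 ∈ T ∧ p.1.2 ∈ T
  let X : Ω → A → ℝ := fun ω p => E p ω
  let Y : Ω → (Aᶜ : Finset (Pairs n)) → ℝ := fun ω p => E p ω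
  have hXY : IndepFun X Y μ := hE.indep.indepFun_finset A Aᶜ disjoint_compl_right hE.measurable
  have hX : Measurable X := measurable_pi_lambda _ fun p => hE.measurable p
  have hE' : Measurable fun ω p => E p ω := measurable_pi_lambda _ fun p => hE.measurable p
  have hobs : ∀ ω, (fun i j : T => observation F (fun p => E p ω) i j) =
      fun i j : T => observation F (extendZero A (X ω)) i j := fun ω => by
    funext i j
    unfold observation extendZero
    split_ifs with h1 h2 h3 h4
    · rfl
    · exact absurd (by simp [A]) h2
    · rfl
    · exact absurd (by simp [A]) h4
    · rfl
  have hnoise : ∀ ω, ∀ i ∉ T, ∀ j, noiseMatrix (fun p => E p ω) i j =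
      noiseMatrix (extendZero Aᶜ (Y ω)) i j := fun ω i hi j => by
    unfold noiseMatrix observation extendZero
    split_ifs with h1 h2 h3 h4
    · rfl
    · exact absurd (by simp [A, hi]) h2
    · rfl
    · exact absurd (by simp [A, hi]) h4
    · rfl
  have hrefine : ∀ ω x, RefineNoiseBound k x (fun p => E p ω) ↔
      RefineNoiseBound (T := T) k x (extendZero Aᶜ (Y ω)) := fun ω x => by
    unfold RefineNoiseBound
    refine forall_congr' fun i => forall_congr' fun hi => ?_
    simp only [hnoise ω i hi]
  let D := regularFinset T k
  let U : (T → Circle) → Set Ω := fun x =>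
    {ω | init T (fun i j => observation F (fun p => E p ω) i j) = x}
  let V : (T → Circle) → Set Ω := fun x => {ω | ¬ RefineNoiseBound k x fun p => E p ω}
  have hUV : ∀ x, μ.real (U x ∩ V x) = μ.real (U x) * μ.real (V x) := fun x => by
    have hU : U x = X ⁻¹' (extendZero A ⁻¹' {w | init T (fun i j => observation F w i j) = x}) := by
      ext ω
      simp only [U, Set.mem_ofPred_eq, Set.mem_preimage, hobs]
    have hV : V x = Y ⁻¹' (extendZero Aᶜ ⁻¹' {w | ¬ RefineNoiseBound k x w}) := by
      ext ω
      simp only [V, Set.mem_ofPred_eq, Set.mem_preimage, hrefine]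
    have hVm : MeasurableSet {w : Pairs n → ℝ | ¬ RefineNoiseBound k x w} :=
      (measurableSet_refineNoiseBound x).compl
    rw [hU, hV, measureReal_def, hXY.measure_inter_preimage_eq_mul _ _
      (measurable_extendZero A (measurableSet_init_eq hinit hT x))
      (measurable_extendZero Aᶜ hVm), ENNReal.toReal_mul]
    rfl
  have hsub : {ω | ¬ RefineNoiseBound k
      (init T fun i j => observation F (fun p => E p ω) i j) fun p => E p ω} =
        ⋃ x ∈ D, U x ∩ V x := by
    have := not_refineNoiseBound_init_eq (F := F) (by omega : n / 4 = k) hinit hT D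
      mem_regularFinset
    have h2 := congrArg (fun s => (fun ω p => E p ω) ⁻¹' s) this
    simp only [Set.preimage_iUnion] at h2
    exact h2
  -- The events `U x` are disjoint, so the bound for fixed positions is averaged rather than
  -- multiplied by the number of positions.
  have hsum : ∑ x ∈ D, μ.real (U x) ≤ 1 := by
    rw [← measureReal_biUnion_finset]
    · exact measureReal_le_one
    · intro x _ y _ hxy
      refine Set.disjoint_left.2 fun ω hx hy => hxy ?_
      exact (show _ = x from hx).symm.trans hy
    · exact fun x _ => hE' (measurableSet_init_eq hinit hT x)
  rw [hsub]
  calc _ ≤ ∑ x ∈ D, μ.real (U x ∩ V x) := measureReal_biUnion_finset_le _ _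
    _ ≤ ∑ x ∈ D, μ.real (U x) * (1 / (2 * (n : ℝ) ^ 2)) := Finset.sum_le_sum fun x _ => by
      rw [hUV]
      gcongr
      exact measureReal_not_refineNoiseBound_le hn hk hE x
    _ = (∑ x ∈ D, μ.real (U x)) * (1 / (2 * (n : ℝ) ^ 2)) := by rw [Finset.sum_mul]
    _ ≤ 1 * (1 / (2 * (n : ℝ) ^ 2)) := by gcongr
    _ = _ := one_mul _

/-! ### The random split and the conclusion. -/

/-- A lower bound on the probability of an event, given the value of a variable that is uniform on
`D` and independent of `Z`. -/
theorem one_sub_le_measureReal_of_uniform {Ω α β : Type*} [MeasurableSpace Ω] [MeasurableSpace α]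
    [MeasurableSingletonClass α] [MeasurableSpace β] {μ : Measure Ω} [IsProbabilityMeasure μ]
    {X : Ω → α} {Z : Ω → β} (hX : Measurable X) (hZ : Measurable Z) (hind : IndepFun Z X μ)
    {D N : Finset α} (hN : N ⊆ D) (hD : D.Nonempty)
    (hunif : ∀ a ∈ D, μ.real {ω | X ω = a} = 1 / (D.card : ℝ)) {b : ℝ} (hb : 0 ≤ b) (G : Set Ω)
    (h : ∀ a ∈ D, a ∉ N → ∃ B : Set β, MeasurableSet B ∧ μ.real (Z ⁻¹' B) ≤ b ∧
      ∀ ω, X ω = a → Z ω ∉ B → ω ∈ G) :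
    1 - ((N.card : ℝ) / D.card + b) ≤ μ.real G := by
  classical
  choose! B hBm hB hBG using h
  -- `G` need not be measurable, so it is bounded from below by a disjoint union of measurable
  -- pieces.
  let W : α → Set Ω := fun a => Z ⁻¹' (B a)ᶜ ∩ X ⁻¹' {a}
  have hsub : ⋃ a ∈ D \ N, W a ⊆ G := by
    refine Set.iUnion₂_subset fun a ha ω hω => ?_
    rw [Finset.mem_sdiff] at ha
    exact hBG a ha.1 ha.2 ω hω.2 hω.1
  have hD0 : (0 : ℝ) < D.card := by exact_mod_cast hD.card_pos
  have hW : ∀ a ∈ D \ N, (1 - b) * (1 / (D.card : ℝ)) ≤ μ.real (W a) := fun a ha => by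
    rw [Finset.mem_sdiff] at ha
    have hm := hBm a ha.1 ha.2
    rw [measureReal_def, hind.measure_inter_preimage_eq_mul _ _ hm.compl (measurableSet_singleton a),
      ENNReal.toReal_mul, ← measureReal_def, ← measureReal_def, Set.preimage_compl,
      probReal_compl_eq_one_sub (hZ hm)]
    have : μ.real (X ⁻¹' {a}) = 1 / (D.card : ℝ) := hunif a ha.1
    rw [this]
    gcongr
    exact hB a ha.1 ha.2
  have hsum : ((D.card : ℝ) - N.card) * ((1 - b) * (1 / (D.card : ℝ))) ≤ μ.real G := by
    refine le_trans ?_ (measureReal_mono hsub)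
    rw [measureReal_biUnion_finset]
    · refine le_trans (le_of_eq ?_) (Finset.card_nsmul_le_sum _ _ _ hW)
      rw [nsmul_eq_mul, Finset.card_sdiff_of_subset hN, Nat.cast_sub (Finset.card_le_card hN)]
    · intro x _ y _ hxy
      refine Set.disjoint_left.2 fun ω hx hy => hxy ?_
      exact (show _ = x from hx.2).symm.trans hy.2
    · intro a ha
      rw [Finset.mem_sdiff] at ha
      exact (hZ (hBm a ha.1 ha.2).compl).inter (hX (measurableSet_singleton a))
  refine le_trans ?_ hsum
  have e : ((D.card : ℝ) - N.card) * ((1 - b) * (1 / (D.card : ℝ))) =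
      1 - (N.card / D.card + b) + b * (N.card / D.card) := by field_simp; ring
  rw [e]
  have : 0 ≤ b * (N.card / (D.card : ℝ)) := by positivity
  linarith

/-- Each admissible first subset has equally many partners, so the first marginal of the split is
uniform. -/
theorem card_splits_filter_fst {n : ℕ} (q : Finset (Fin n) → Prop) [DecidablePred q] :
    ((splits n).filter fun P => q P.1).card =
      ((Finset.powersetCard (n / 4) Finset.univ).filter q).card *
        (n - n / 4).choose (n / 4) := by
  rw [Finset.card_eq_sum_card_fiberwise (f := Prod.fst)
    (t := (Finset.powersetCard (n / 4) Finset.univ).filter q)]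
  · rw [Finset.sum_const_nat]
    intro T hT
    rw [Finset.mem_filter, Finset.mem_powersetCard] at hT
    have : ((Finset.powersetCard (n / 4) Tᶜ)).card = (n - n / 4).choose (n / 4) := by
      rw [Finset.card_powersetCard, Finset.card_compl, hT.1.2, Fintype.card_fin]
    rw [← this]
    refine (Finset.card_bij (fun T' _ => (T, T')) (fun T' hT' => ?_) (by simp) ?_).symm
    · rw [Finset.mem_powersetCard] at hT'
      simp only [splits, Finset.mem_filter, Finset.mem_product, Finset.mem_powersetCard]
      exact ⟨⟨⟨⟨⟨Finset.subset_univ _, hT.1.2⟩, Finset.subset_univ _, hT'.2⟩,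
        Finset.disjoint_left.2 fun a ha ha' => Finset.mem_compl.1 (hT'.1 ha') ha⟩, hT.2⟩, trivial⟩
    · rintro ⟨T₁, T'⟩ h
      simp only [splits, Finset.mem_filter, Finset.mem_product, Finset.mem_powersetCard] at h
      obtain ⟨⟨⟨⟨-, -, hc⟩, hd⟩, -⟩, rfl⟩ := h
      refine ⟨T', Finset.mem_powersetCard.2 ⟨fun a ha => Finset.mem_compl.2 fun ha' =>
        Finset.disjoint_left.1 hd ha' ha, hc⟩, rfl⟩
  · intro P hP
    simp only [splits, Finset.coe_filter, Finset.mem_filter, Finset.mem_product,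
      Set.mem_ofPred_eq] at hP ⊢
    exact ⟨hP.1.1.1, hP.2⟩

/-- The set of splits is invariant under the swap, so both marginals obey the same count. -/
theorem card_splits_filter_snd {n : ℕ} (q : Finset (Fin n) → Prop) [DecidablePred q] :
    ((splits n).filter fun P => q P.2).card = ((splits n).filter fun P => q P.1).card := by
  refine Finset.card_equiv (Equiv.prodComm _ _) fun P => ?_
  simp only [splits, Finset.mem_filter, Finset.mem_product, Equiv.prodComm_apply, Prod.fst_swap,
    Prod.snd_swap, disjoint_comm (a := P.1), and_comm (a := P.1 ∈ _)]

theorem card_splits (n : ℕ) :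
    (splits n).card = n.choose (n / 4) * (n - n / 4).choose (n / 4) := by
  have := card_splits_filter_fst (n := n) fun _ => True
  simpa using this

theorem two_mul_torusDist_le (n : ℕ) (a b : ℤ) : 2 * torusDist n a b ≤ n := by
  rw [torusDist]; omega

/-- Most splits are made of two spread subsets. -/
theorem card_splits_not_isSpread_le {n k : ℕ} (hn : n = 4 * k) (hk : 0 < k)
    (σ : Equiv.Perm (Fin n)) {s : ℝ} (hs : s = √(n * Real.log n))
    [DecidablePred (IsSpread σ (8 * s))] :
    (((splits n).filter fun P => ¬ IsSpread σ (8 * s) P.1 ∨ ¬ IsSpread σ (8 * s) P.2).card : ℝ) /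
      (splits n).card ≤ 2 / (n : ℝ) ^ 2 := by
  have hn4 : n / 4 = k := by omega
  have h1 := card_not_isSpread_le hk hn σ hs
  have h2 := card_splits_filter_fst (n := n) fun T => ¬ IsSpread σ (8 * s) T
  have h3 := card_splits_filter_snd (n := n) fun T => ¬ IsSpread σ (8 * s) T
  have h4 := card_splits n
  rw [hn4] at h2 h4
  rw [Finset.filter_or]
  have h5 := Finset.card_union_le ((splits n).filter fun P => ¬ IsSpread σ (8 * s) P.1)
    ((splits n).filter fun P => ¬ IsSpread σ (8 * s) P.2)
  rw [h3, h2] at h5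
  have hc1 : (0 : ℝ) < n.choose k := by exact_mod_cast Nat.choose_pos (by omega)
  have hc2 : (0 : ℝ) < (n - k).choose k := by exact_mod_cast Nat.choose_pos (by omega)
  have hn0 : (0 : ℝ) < n := by exact_mod_cast (by omega : 0 < n)
  rw [h4, div_le_iff₀ (by push_cast; positivity)]
  refine (Nat.cast_le.2 h5).trans ?_
  push_cast
  calc _ = 2 * (((Finset.powersetCard k (Finset.univ : Finset (Fin n))).filter
        fun T => ¬ IsSpread σ (8 * s) T).card : ℝ) * (n - k).choose k := by ring
    _ ≤ 2 * (n.choose k / (n : ℝ) ^ 2) * (n - k).choose k := by gcongr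
    _ = _ := by ring

theorem splits_nonempty {n : ℕ} : (splits n).Nonempty := by
  rw [← Finset.card_pos, card_splits]
  exact Nat.mul_pos (Nat.choose_pos (by omega)) (Nat.choose_pos (by omega))

theorem corollary3p4 (cl cL ce : ℝ) (hcl : 0 < cl) (hcL : cl ≤ cL) (hce : 0 ≤ ce) :
    ∃ C : ℝ, 0 < C ∧
      ∀ (n : ℕ), 0 < n → 4 ∣ n →
      ∀ (F : Matrix (Fin n) (Fin n) ℝ), F.IsSymm →
      ∀ (σ : Equiv.Perm (Fin n)), TorusBiLipschitz cl cL ce (F.submatrix σ.symm σ.symm) →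
      ∀ {Ω : Type*} [MeasurableSpace Ω] (μ : Measure Ω) [IsProbabilityMeasure μ]
        (E : Pairs n → Ω → ℝ), IsSubGaussianNoise μ E →
      ∀ (S S' : Ω → Finset (Fin n)), IsUniformSplit μ S S' →
        IndepFun (fun ω p => E p ω) (fun ω => (S ω, S' ω)) μ →
      ∀ (init init' : (T : Finset (Fin n)) → (T → T → ℝ) → (T → Circle)),
        IsInitRule init → IsInitRule init' →
        1 - 5 / (n : ℝ) ^ 2 ≤ μ.real {ω |
          ∀ x, IsOutput init init' (observation F fun p => E p ω) (S ω) (S' ω) x →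
            ∃ τ ∈ symmetryGroup n, ∀ i,
              (torusDist n (label (τ (σ i))) (sigmaHat x i) : ℝ)
                ≤ C * Real.sqrt (n * Real.log n)} := by
  classical
  have hcL0 : 0 < cL := hcl.trans_le hcL
  have hK : 0 < refineConst cl cL ce := by
    have : 0 < initConst cl cL ce := by rw [initConst]; positivity
    rw [refineConst]; positivity
  refine ⟨7 * refineConst cl cL ce + 8, by positivity, ?_⟩
  intro n hn0 ⟨k, hn⟩ F hF σ hσ Ω _ μ _ E hE S S' hS hind init init' hinit hinit'
  have hk : 1 ≤ k := by omega
  have hn4 : n / 4 = k := by omega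
  have hnr : (0 : ℝ) < n := by exact_mod_cast hn0
  have hnr4 : (4 : ℝ) ≤ n := by exact_mod_cast (by omega : 4 ≤ n)
  -- The frame identity needs three grid points. Otherwise `n ≤ 8`, torus distances are at most 4,
  -- and the constant exceeds 8.
  rcases Nat.lt_or_ge k 3 with hk3 | hk3
  · have hlog : 1 ≤ Real.log n := by
      rw [Real.le_log_iff_exp_le hnr]
      linarith [Real.exp_one_lt_d9]
    have hL : 1 ≤ √(n * Real.log n) := by
      rw [Real.one_le_sqrt]; nlinarith
    refine le_trans ?_ (le_of_eq (probReal_univ (μ := μ)).symm) |>.trans (measureReal_mono ?_)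
    · have : (0 : ℝ) ≤ 5 / (n : ℝ) ^ 2 := by positivity
      linarith
    · intro ω _ x _
      refine ⟨1, one_mem _, fun i => ?_⟩
      have h1 := two_mul_torusDist_le n (label ((1 : Equiv.Perm (Fin n)) (σ i))) (sigmaHat x i)
      have h2 : torusDist n (label ((1 : Equiv.Perm (Fin n)) (σ i))) (sigmaHat x i) ≤ 4 := by omega
      have h3 : (torusDist n (label ((1 : Equiv.Perm (Fin n)) (σ i))) (sigmaHat x i) : ℝ) ≤ 4 := by
        exact_mod_cast h2
      nlinarith
  obtain ⟨s, hs⟩ : ∃ s, s = √(n * Real.log n) := ⟨_, rfl⟩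
  let N := (splits n).filter fun P => ¬ IsSpread σ (8 * s) P.1 ∨ ¬ IsSpread σ (8 * s) P.2
  have hN : (N.card : ℝ) / (splits n).card ≤ 2 / (n : ℝ) ^ 2 :=
    card_splits_not_isSpread_le hn hk σ hs
  have hZ : Measurable fun ω p => E p ω := measurable_pi_lambda _ fun p => hE.measurable p
  -- Failure budget: `2 / n²` for a split that is not spread, and four noise events of probability
  -- at most `1 / (2n²)` each.
  have hmain := one_sub_le_measureReal_of_uniform (hS.measurable_fst.prodMk hS.measurable_snd) hZ
    hind (N := N) (Finset.filter_subset _ _) splits_nonempty hS.uniform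
    (b := 2 / (n : ℝ) ^ 2) (by positivity) {ω |
          ∀ x, IsOutput init init' (observation F fun p => E p ω) (S ω) (S' ω) x →
            ∃ τ ∈ symmetryGroup n, ∀ i,
              (torusDist n (label (τ (σ i))) (sigmaHat x i) : ℝ)
                ≤ (7 * refineConst cl cL ce + 8) * √(n * Real.log n)} (by
    rintro ⟨T, T'⟩ hT hTN
    have hspread : IsSpread σ (8 * s) T ∧ IsSpread σ (8 * s) T' := by
      simp only [N, Finset.mem_filter, hT, true_and] at hTN
      push Not at hTN
      exact hTN
    simp only [splits, Finset.mem_filter, Finset.mem_product, Finset.mem_powersetCard] at hT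
    obtain ⟨⟨⟨-, hc⟩, -, hc'⟩, hdisj⟩ := hT
    obtain ⟨e, he⟩ := hspread.1.exists_regular (hc.trans hn4) hk hn
    obtain ⟨e', he'⟩ := hspread.2.exists_regular (hc'.trans hn4) hk hn
    rw [hs] at he he'
    have m1 := (measurableSet_initNoiseBound e).compl
    have m2 := (measurableSet_initNoiseBound e').compl
    have m3 := measurableSet_not_refineNoiseBound_init hn4 (F := F) hinit hc
    have m4 := measurableSet_not_refineNoiseBound_init hn4 (F := F) hinit' hc'
    refine ⟨_, (m1.union m2).union (m3.union m4), ?_, fun ω hω hB x hx => ?_⟩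
    · have p1 := measureReal_not_initNoiseBound_le hn hk hE e
      have p2 := measureReal_not_initNoiseBound_le hn hk hE e'
      have p3 := measureReal_not_refineNoiseBound_init_le hn hk hE (F := F) hinit hc
      have p4 := measureReal_not_refineNoiseBound_init_le hn hk hE (F := F) hinit' hc'
      rw [Set.preimage_union, Set.preimage_union, Set.preimage_union]
      refine (measureReal_union_le _ _).trans ((add_le_add (measureReal_union_le _ _)
        (measureReal_union_le _ _)).trans ((add_le_add (add_le_add p1 p2)
          (add_le_add p3 p4)).trans (le_of_eq ?_)))
      field_simp; norm_num
    · obtain ⟨rfl, rfl⟩ := Prod.mk.inj hω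
      simp only [Set.mem_union, Set.mem_compl_iff, Set.mem_ofPred_eq, not_or, not_not] at hB
      exact exists_symmetryGroup_of_isOutput hk3 hn hcl hcL hce hF hσ hinit hinit' hdisj e e' he he'
        hB.1.1 hB.1.2 hB.2.1 hB.2.2 hx)
  refine le_trans ?_ hmain
  have : 2 / (n : ℝ) ^ 2 + 2 / (n : ℝ) ^ 2 ≤ 5 / (n : ℝ) ^ 2 := by
    rw [← add_div]; gcongr; norm_num
  linarith
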